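/- Let $n\ge 1$, let $g_1,\dots,g_{n_X}\in\mathbb R[x]=\mathbb R[x_1,\dots,x_n]$ and $X=\{x\in\mathbb R^n: g_j(x)\ge 0,\ j=1,\dots,n_X\}$. Assume that either some $g_j$ equals $R^2-\sum_i x_i^2$ for a real $R$, or $X$ has nonempty interior and some polynomial $R^2-\sum_i x_i^2$ lies in the quadratic module generated by the $g_j$ (in both cases $X$ is compact with an algebraic certificate). Put $k_j=\lceil \deg g_j/2\rceil$ and $k_X=\max\{1,k_1,\dots,k_{n_X}\}$. Let $\mathbf a=(a_1,\dots,a_m)$ be polynomials of degree at most $d$, let $\mathbf b\in\mathbb R^m$, and let $k\ge\max\{d,k_X\}$. For $y=(y_\alpha)_{|\alpha|\le 2k}$ put $\ell_y(\sum p_\alpha x^\alpha)=\sum p_\alpha y_\alpha$, and let $M_r(g\,y)$ be the matrix of the quadratic form $p\mapsto \ell_y(g p^2)$ on polynomials of degree at most $r$, in the monomial basis, with $M_r(y)=M_r(1\,y)$. The moment SDP of order $k$ is to minimize $y_{+0}+y_{-0}$ subject to $\ell_{y_+}(a_i)-\ell_{y_-}(a_i)=b_i$ ($i=1,\dots,m$),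 $M_k(y_\pm)\succeq 0$ and $M_{k-k_j}(g_j\,y_\pm)\succeq 0$ ($j=1,\dots,n_X$). The SOS SDP of order $k$ is to maximize $\mathbf b^\top\mathbf u$ over $\mathbf u\in\mathbb R^m$ such that both polynomials $1\pm\mathbf a^\top\mathbf u$ (where $\mathbf a^\top\mathbf u=\sum_i u_i a_i$) are of the form $p_0+\sum_j g_jp_j$, with $p_0$ a sum of squares of polynomials of degree at most $k$ and $p_j$ a sum of squares of polynomials of degree at most $k-k_j$. The measure LP is to minimize $\mu_+(X)+\mu_-(X)$ over pairs of finite nonnegative Borel measures on $X$ with $\int a_i\,d\mu_+-\int a_i\,d\mu_-=b_i$ for all $i$. Let $(y_+^*,y_-^*)$ be an optimal solution of the moment SDP such that $\operatorname{rank}M_{k-k_X}(y^*_+)=\operatorname{rank}M_k(y^*_+)=:r_+$ and $\operatorname{rank}M_{k-k_X}(y^*_-)=\operatorname{rank}M_k(y^*_-)=:r_-$, and let $\mathbf u^*$ be an optimal solution of the SOS SDP. Then there are finite nonnegative Borel measures $\mu^*_+,\mu^*_-$ on $X$ with $\int x^\alpha\,d\mu^*_\pm=y^*_{\pm\alpha}$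 for all $|\alpha|\le 2k$. Moreover, for any such $\mu^*_+,\mu^*_-$: 1. $(\mu_+^*,\mu_-^*)$ is optimal for the measure LP, and the supports of $\mu^*_+$ and $\mu^*_-$ consist of exactly $r_+$ and $r_-$ points of $X$; 2. $1-\mathbf a^\top\mathbf u^*$ vanishes at the $r_+$ points of the support of $\mu_+^*$, and $1+\mathbf a^\top\mathbf u^*$ vanishes at the $r_-$ points of the support of $\mu_-^*$; 3. hence $\mathbf a^\top\mathbf u^*$ is a polynomial certificate of optimality: $|\mathbf a^\top\mathbf u^*|\le 1$ on $X$, it equals $1$ on the support of $\mu^*_+$ and $-1$ on the support of $\mu^*_-$, and $\mathbf b^\top\mathbf u^*=\mu_+^*(X)+\mu_-^*(X)$. -/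

import Mathlib

open MvPolynomial MeasureTheory

namespace MomentSOS

/-- Exponents `α ∈ ℕⁿ` with `|α| ≤ r`; they index the monomial basis of `ℝ[x]_r`. -/
abbrev MonIdx (n r : ℕ) : Type := {α : Fin n →₀ ℕ // α.degree ≤ r}

noncomputable instance (n r : ℕ) : Fintype (MonIdx n r) :=
  (Finsupp.finite_of_degree_le (σ := Fin n) r).fintype

/-- The basic closed semialgebraic set `{x : g_j(x) ≥ 0 for all j}`. -/
def semialgSet {n nX : ℕ} (g : Fin nX → MvPolynomial (Fin n) ℝ) : Set (Fin n → ℝ) :=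
  {x | ∀ j, 0 ≤ eval x (g j)}

/-- `⌈deg p / 2⌉`. -/
noncomputable def halfDeg {n : ℕ} (p : MvPolynomial (Fin n) ℝ) : ℕ := (p.totalDegree + 1) / 2

/-- `k_X = max {1, k_1, …, k_{n_X}}` with `k_j = ⌈deg g_j / 2⌉`. -/
noncomputable def minOrder {n nX : ℕ} (g : Fin nX → MvPolynomial (Fin n) ℝ) : ℕ :=
  max 1 (Finset.univ.sup fun j => halfDeg (g j))

/-- The linear combination `aᵀu = ∑ i, u_i a_i`. -/
noncomputable def lincomb {n m : ℕ} (a : Fin m → MvPolynomial (Fin n) ℝ) (u : Fin m → ℝ) :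
    MvPolynomial (Fin n) ℝ :=
  ∑ i, C (u i) * a i

/-! ### Sums of squares and the truncated quadratic module -/

/-- Finite sums of squares of polynomials of degree at most `r`. -/
def sosCone (n r : ℕ) : Set (MvPolynomial (Fin n) ℝ) :=
  {p | ∃ (N : ℕ) (q : Fin N → MvPolynomial (Fin n) ℝ),
    (∀ i, (q i).totalDegree ≤ r) ∧ p = ∑ i, q i ^ 2}

/-- The truncated quadratic module of order `k` (used for `k ≥ k_X`): all
`p₀ + ∑ j, g_j p_j` with `p₀` a sum of squares of polynomials of degree at most `k` and
`p_j` a sum of squares of polynomials of degree at most `k - k_j`. -/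
def quadModule {n nX : ℕ} (g : Fin nX → MvPolynomial (Fin n) ℝ) (k : ℕ) :
    Set (MvPolynomial (Fin n) ℝ) :=
  {q | ∃ p₀ ∈ sosCone n k, ∃ p : Fin nX → MvPolynomial (Fin n) ℝ,
    (∀ j, p j ∈ sosCone n (k - halfDeg (g j))) ∧ q = p₀ + ∑ j, g j * p j}

/-- The polynomial `R² - ∑ i, x_i²`. -/
noncomputable def ballPoly (n : ℕ) (R : ℝ) : MvPolynomial (Fin n) ℝ :=
  C (R ^ 2) - ∑ i, X i ^ 2

/-- The algebraic certificate of compactness: some `R² - ∑ i, x_i²` lies in the quadratic module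
generated by `g`, that is, in one of its truncations. -/
def IsArchimedean {n nX : ℕ} (g : Fin nX → MvPolynomial (Fin n) ℝ) : Prop :=
  ∃ R : ℝ, ∃ k ≥ minOrder g, ballPoly n R ∈ quadModule g k

/-! ### Moment and localizing matrices -/

/-- The Riesz functional `ℓ_y(p) = ∑ α, p_α y_α` of a truncated sequence `(y_α)_{|α| ≤ s}`
(meaningful for `deg p ≤ s`). -/
noncomputable def riesz {n s : ℕ} (y : MonIdx n s → ℝ) (p : MvPolynomial (Fin n) ℝ) : ℝ :=
  ∑ α : MonIdx n s, coeff α.1 p * y α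

/-- The localizing matrix `M_r(g y)`, the Gram matrix of `p ↦ ℓ_y(g p²)` on `ℝ[x]_r` in the
monomial basis. -/
noncomputable def locMatrix {n s : ℕ} (r : ℕ) (g : MvPolynomial (Fin n) ℝ)
    (y : MonIdx n s → ℝ) : Matrix (MonIdx n r) (MonIdx n r) ℝ :=
  Matrix.of fun α β => riesz y (g * (monomial α.1 1 * monomial β.1 1))

/-- The moment matrix `M_r(y)`, the Gram matrix of `p ↦ ℓ_y(p²)` on `ℝ[x]_r`. -/
noncomputable def momMatrix {n s : ℕ} (r : ℕ) (y : MonIdx n s → ℝ) :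
    Matrix (MonIdx n r) (MonIdx n r) ℝ :=
  locMatrix r 1 y

/-- The truncated moment cone of order `k` (used for `k ≥ k_X`). -/
def momCone {n nX : ℕ} (g : Fin nX → MvPolynomial (Fin n) ℝ) (k : ℕ) :
    Set (MonIdx n (2 * k) → ℝ) :=
  {y | (momMatrix k y).PosSemidef ∧ ∀ j, (locMatrix (k - halfDeg (g j)) (g j) y).PosSemidef}

/-! ### The primal moment SDP and the dual SOS SDP of order `k` -/

/-- Feasibility in the moment relaxation of order `k`. -/
def MomFeasible {n nX m : ℕ} (g : Fin nX → MvPolynomial (Fin n) ℝ)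
    (a : Fin m → MvPolynomial (Fin n) ℝ) (b : Fin m → ℝ) (k : ℕ)
    (yp ym : MonIdx n (2 * k) → ℝ) : Prop :=
  yp ∈ momCone g k ∧ ym ∈ momCone g k ∧ ∀ i, riesz yp (a i) - riesz ym (a i) = b i

/-- `(y₊, y₋)` minimizes `y_{+0} + y_{-0}` over the moment relaxation of order `k`. -/
def MomOptimal {n nX m : ℕ} (g : Fin nX → MvPolynomial (Fin n) ℝ)
    (a : Fin m → MvPolynomial (Fin n) ℝ) (b : Fin m → ℝ) (k : ℕ)
    (yp ym : MonIdx n (2 * k) → ℝ) : Prop :=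
  MomFeasible g a b k yp ym ∧
    ∀ zp zm : MonIdx n (2 * k) → ℝ, MomFeasible g a b k zp zm →
      riesz yp 1 + riesz ym 1 ≤ riesz zp 1 + riesz zm 1

/-- Feasibility in the SOS strengthening of order `k`. -/
def SOSFeasible {n nX m : ℕ} (g : Fin nX → MvPolynomial (Fin n) ℝ)
    (a : Fin m → MvPolynomial (Fin n) ℝ) (k : ℕ) (u : Fin m → ℝ) : Prop :=
  1 + lincomb a u ∈ quadModule g k ∧ 1 - lincomb a u ∈ quadModule g k

/-- `u` maximizes `bᵀu` over the SOS strengthening of order `k`. -/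
def SOSOptimal {n nX m : ℕ} (g : Fin nX → MvPolynomial (Fin n) ℝ)
    (a : Fin m → MvPolynomial (Fin n) ℝ) (b : Fin m → ℝ) (k : ℕ) (u : Fin m → ℝ) : Prop :=
  SOSFeasible g a k u ∧ ∀ v : Fin m → ℝ, SOSFeasible g a k v → b ⬝ᵥ v ≤ b ⬝ᵥ u

/-! ### The linear program on measures -/

/-- `μ` is a finite nonnegative Borel measure on the set `S`. -/
def IsMeasureOn {n : ℕ} (S : Set (Fin n → ℝ)) (μ : Measure (Fin n → ℝ)) : Prop :=
  IsFiniteMeasure μ ∧ μ Sᶜ = 0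

/-- Feasibility in the linear program on pairs of nonnegative measures. -/
def LPFeasible {n nX m : ℕ} (g : Fin nX → MvPolynomial (Fin n) ℝ)
    (a : Fin m → MvPolynomial (Fin n) ℝ) (b : Fin m → ℝ) (μp μm : Measure (Fin n → ℝ)) : Prop :=
  IsMeasureOn (semialgSet g) μp ∧ IsMeasureOn (semialgSet g) μm ∧
    ∀ i, ∫ x, eval x (a i) ∂μp - ∫ x, eval x (a i) ∂μm = b i

/-- `(μ₊, μ₋)` minimizes the total mass in the linear program on measures. -/
def LPOptimal {n nX m : ℕ} (g : Fin nX → MvPolynomial (Fin n) ℝ)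
    (a : Fin m → MvPolynomial (Fin n) ℝ) (b : Fin m → ℝ) (μp μm : Measure (Fin n → ℝ)) : Prop :=
  LPFeasible g a b μp μm ∧
    ∀ νp νm : Measure (Fin n → ℝ), LPFeasible g a b νp νm →
      μp.real Set.univ + μm.real Set.univ ≤ νp.real Set.univ + νm.real Set.univ

/-- `μ` is a measure on `S` whose moments of order `|α| ≤ s` are the `y_α`. -/
def Represents {n s : ℕ} (S : Set (Fin n → ℝ)) (y : MonIdx n s → ℝ)
    (μ : Measure (Fin n → ℝ)) : Prop :=
  IsMeasureOn S μ ∧ ∀ α : MonIdx n s, y α = ∫ x, eval x (monomial α.1 (1 : ℝ)) ∂μ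

/-- `aᵀu` is a polynomial certificate of optimality for `(μ₊, μ₋)`: it is bounded by `1` in absolute
value on `X`, it equals `1` on the support of `μ₊` and `-1` on the support of `μ₋`, and the dual
value `bᵀu` equals the total mass of `(μ₊, μ₋)`. -/
def IsCertificate {n nX m : ℕ} (g : Fin nX → MvPolynomial (Fin n) ℝ)
    (a : Fin m → MvPolynomial (Fin n) ℝ) (b : Fin m → ℝ) (u : Fin m → ℝ)
    (μp μm : Measure (Fin n → ℝ)) : Prop :=
  (∀ x ∈ semialgSet g, |eval x (lincomb a u)| ≤ 1) ∧
  (∀ x ∈ μp.support, eval x (lincomb a u) = 1) ∧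
  (∀ x ∈ μm.support, eval x (lincomb a u) = -1) ∧
  b ⬝ᵥ u = μp.real Set.univ + μm.real Set.univ

end MomentSOS

open MomentSOS

/-! Flatness turns each optimal sequence into a finite sum of weighted point evaluations. Factor
`M_k(y) = BᵀB` and map a polynomial to `B` times its coefficient vector; the range is a Euclidean
space in which inner products are `ℓ_y(pq)`. The rank condition says that polynomials of degree at
most `k - k_X < k` already fill this space, so multiplication by the variables descends to commuting
symmetric operators. Their joint eigenvalues are the atoms, the squared norms of the joint
eigencomponents of the class of `1` are the weights, and low-degree preimages of these components
interpolate at the atoms (`exists_atoms_of_gns`). The interpolation polynomials do three further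
jobs: they place the atoms in `X` by testing the localizing matrices, they show that the rank counts
the atoms, and they force every representing measure to have exactly these atoms as its support
(`exists_atoms_of_flat`, `support_eq_of_atoms`).

Optimality for the measure LP is immediate, because moments of LP-feasible measures are feasible for
the moment SDP. The certificate needs equal SDP values. A separating functional in the space of two
coefficient vectors and a value is a pair of truncated sequences with a multiplier `τ`; when `τ >
0`, rescaling by `τ` contradicts moment optimality. With an explicit ball constraint, `1` is
interior to the truncated quadratic module, which excludes `τ = 0`
(`exists_sosFeasible_of_ballPoly`). With nonempty interior, Lebesgue moments give a strictly
positive point, and compactness of normalized generators allows strict separation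
(`exists_sosFeasible_of_interior`). Complementary slackness then finishes the proof. -/

namespace MomentSOS

/-! ### Polynomials as coefficient vectors, Riesz functionals and the truncated cones. -/

variable {n nX m r s k : ℕ}

/-- The polynomial with prescribed coefficients in the monomial basis of `ℝ[x]_r`. -/
noncomputable def toPoly : (MonIdx n r → ℝ) →ₗ[ℝ] MvPolynomial (Fin n) ℝ :=
  ∑ α : MonIdx n r, monomial α.1 ∘ₗ LinearMap.proj α

/-- The coefficients of order at most `r` of a polynomial. -/
noncomputable def coeffVec (n r : ℕ) : MvPolynomial (Fin n) ℝ →ₗ[ℝ] (MonIdx n r → ℝ) :=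
  LinearMap.pi fun α => lcoeff ℝ α.1

@[simp] lemma coeffVec_apply (p : MvPolynomial (Fin n) ℝ) (α : MonIdx n r) :
    coeffVec n r p α = coeff α.1 p := rfl

lemma toPoly_apply (v : MonIdx n r → ℝ) : toPoly v = ∑ α, monomial α.1 (v α) := by
  simp [toPoly]

lemma degree_le_of_mem_support {p : MvPolynomial (Fin n) ℝ} (hp : p.totalDegree ≤ r)
    {α : Fin n →₀ ℕ} (h : α ∈ p.support) : α.degree ≤ r :=
  (le_totalDegree h).trans hp

lemma totalDegree_monomial_le' (α : Fin n →₀ ℕ) (c : ℝ) :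
    (monomial α c).totalDegree ≤ α.degree := totalDegree_monomial_le α c

lemma totalDegree_toPoly_le (v : MonIdx n r → ℝ) : (toPoly v).totalDegree ≤ r := by
  rw [toPoly_apply]
  exact totalDegree_finsetSum_le fun α _ => (totalDegree_monomial_le' _ _).trans α.2

lemma coeffVec_toPoly (v : MonIdx n r → ℝ) : coeffVec n r (toPoly v) = v := by
  classical
  ext α
  simp only [coeffVec_apply, toPoly_apply, coeff_sum, coeff_monomial]
  simp [Subtype.val_inj]

lemma eq_of_coeffVec_eq {p q : MvPolynomial (Fin n) ℝ} (hp : p.totalDegree ≤ r)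
    (hq : q.totalDegree ≤ r) (h : coeffVec n r p = coeffVec n r q) : p = q := by
  ext α
  by_cases hα : α.degree ≤ r
  · exact congrFun h ⟨α, hα⟩
  · rw [notMem_support_iff.1 fun h' => hα (degree_le_of_mem_support hp h'),
      notMem_support_iff.1 fun h' => hα (degree_le_of_mem_support hq h')]

lemma toPoly_coeffVec {p : MvPolynomial (Fin n) ℝ} (hp : p.totalDegree ≤ r) :
    toPoly (coeffVec n r p) = p :=
  eq_of_coeffVec_eq (totalDegree_toPoly_le _) hp (coeffVec_toPoly _)

/-- Linear maps that agree on the monomials of degree at most `s` agree on `ℝ[x]_s`. -/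
lemma linearMap_eq_of_monomial {E : Type*} [AddCommGroup E] [Module ℝ E]
    {f h : MvPolynomial (Fin n) ℝ →ₗ[ℝ] E}
    (H : ∀ α : Fin n →₀ ℕ, α.degree ≤ s → f (monomial α 1) = h (monomial α 1))
    {p : MvPolynomial (Fin n) ℝ} (hp : p.totalDegree ≤ s) : f p = h p := by
  rw [p.as_sum, map_sum, map_sum]
  refine Finset.sum_congr rfl fun α hα => ?_
  have : monomial α (coeff α p) = coeff α p • monomial α (1 : ℝ) := by
    rw [smul_monomial, smul_eq_mul, mul_one]
  rw [this, map_smul, map_smul, H α (degree_le_of_mem_support hp hα)]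

/-- The Riesz functional as a linear map. -/
noncomputable def rieszLin (y : MonIdx n s → ℝ) : MvPolynomial (Fin n) ℝ →ₗ[ℝ] ℝ :=
  ∑ α : MonIdx n s, y α • lcoeff ℝ α.1

lemma rieszLin_apply (y : MonIdx n s → ℝ) (p : MvPolynomial (Fin n) ℝ) :
    rieszLin y p = riesz y p := by
  simp [rieszLin, riesz, mul_comm]

lemma riesz_eq_dotProduct (y : MonIdx n s → ℝ) (p : MvPolynomial (Fin n) ℝ) :
    riesz y p = coeffVec n s p ⬝ᵥ y := rfl

lemma riesz_monomial (y : MonIdx n s → ℝ) (α : MonIdx n s) :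
    riesz y (monomial α.1 1) = y α := by
  classical
  simp [riesz, coeff_monomial, Subtype.val_inj]

lemma riesz_add (y : MonIdx n s → ℝ) (p q : MvPolynomial (Fin n) ℝ) :
    riesz y (p + q) = riesz y p + riesz y q := by
  simp only [← rieszLin_apply, map_add]

lemma riesz_sub (y : MonIdx n s → ℝ) (p q : MvPolynomial (Fin n) ℝ) :
    riesz y (p - q) = riesz y p - riesz y q := by
  simp only [← rieszLin_apply, map_sub]

lemma riesz_sum {ι : Type*} (t : Finset ι) (y : MonIdx n s → ℝ)
    (p : ι → MvPolynomial (Fin n) ℝ) : riesz y (∑ i ∈ t, p i) = ∑ i ∈ t, riesz y (p i) := by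
  simp only [← rieszLin_apply, map_sum]

lemma riesz_add_left (y z : MonIdx n s → ℝ) (p : MvPolynomial (Fin n) ℝ) :
    riesz (y + z) p = riesz y p + riesz z p := by
  simp only [riesz_eq_dotProduct, dotProduct_add]

lemma riesz_smul_left (c : ℝ) (y : MonIdx n s → ℝ) (p : MvPolynomial (Fin n) ℝ) :
    riesz (c • y) p = c * riesz y p := by
  simp only [riesz_eq_dotProduct, dotProduct_smul, smul_eq_mul]

lemma riesz_lincomb (y : MonIdx n s → ℝ) (a : Fin m → MvPolynomial (Fin n) ℝ) (u : Fin m → ℝ) :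
    riesz y (lincomb a u) = ∑ i, u i * riesz y (a i) := by
  simp only [lincomb, ← smul_eq_C_mul, ← rieszLin_apply, map_sum, map_smul, smul_eq_mul]

lemma dotProduct_locMatrix_mulVec (g : MvPolynomial (Fin n) ℝ) (y : MonIdx n s → ℝ)
    (v w : MonIdx n r → ℝ) :
    v ⬝ᵥ (locMatrix r g y).mulVec w = riesz y (g * (toPoly v * toPoly w)) := by
  have h : ∀ (α : MonIdx n r) (u : MonIdx n r → ℝ), monomial α.1 (u α) =
      u α • monomial α.1 (1 : ℝ) := fun α u => by rw [smul_monomial, smul_eq_mul, mul_one]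
  simp only [toPoly_apply, h, dotProduct, Matrix.mulVec, locMatrix, Matrix.of_apply]
  rw [Finset.sum_mul_sum]
  simp only [Finset.mul_sum, ← rieszLin_apply, map_sum]
  refine Finset.sum_congr rfl fun α _ => Finset.sum_congr rfl fun β _ => ?_
  rw [smul_mul_smul_comm, mul_smul_comm, map_smul, smul_eq_mul]
  ring

lemma locMatrix_isHermitian (g : MvPolynomial (Fin n) ℝ) (y : MonIdx n s → ℝ) :
    (locMatrix r g y).IsHermitian := by
  ext α β
  simp [locMatrix, add_comm]

/-- This translates semidefiniteness into inequalities on polynomials, the only form in which it is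
used for localizing matrices. -/
lemma locMatrix_posSemidef_iff (g : MvPolynomial (Fin n) ℝ) (y : MonIdx n s → ℝ) :
    (locMatrix r g y).PosSemidef ↔
      ∀ q : MvPolynomial (Fin n) ℝ, q.totalDegree ≤ r → 0 ≤ riesz y (g * q ^ 2) := by
  constructor
  · intro h q hq
    have := h.dotProduct_mulVec_nonneg (coeffVec n r q)
    rw [star_trivial, dotProduct_locMatrix_mulVec, toPoly_coeffVec hq] at this
    rwa [sq]
  · intro h
    refine .of_dotProduct_mulVec_nonneg (locMatrix_isHermitian g y) fun v => ?_
    rw [star_trivial, dotProduct_locMatrix_mulVec, ← sq]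
    exact h _ (totalDegree_toPoly_le v)

lemma mem_momCone_iff {g : Fin nX → MvPolynomial (Fin n) ℝ} {y : MonIdx n (2 * k) → ℝ} :
    y ∈ momCone g k ↔
      (∀ q : MvPolynomial (Fin n) ℝ, q.totalDegree ≤ k → 0 ≤ riesz y (q ^ 2)) ∧
      ∀ j, ∀ q : MvPolynomial (Fin n) ℝ, q.totalDegree ≤ k - halfDeg (g j) →
        0 ≤ riesz y (g j * q ^ 2) := by
  simp only [momCone, momMatrix, Set.mem_ofPred_eq, locMatrix_posSemidef_iff, one_mul]

/-- Weak duality: both cones are built from the same squares `q²` and `g_j q²`. -/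
lemma riesz_nonneg_of_mem_quadModule {g : Fin nX → MvPolynomial (Fin n) ℝ}
    {y : MonIdx n (2 * k) → ℝ} (hy : y ∈ momCone g k) {q : MvPolynomial (Fin n) ℝ}
    (hq : q ∈ quadModule g k) : 0 ≤ riesz y q := by
  rw [mem_momCone_iff] at hy
  obtain ⟨p₀, ⟨N, q₀, hq₀, rfl⟩, p, hp, rfl⟩ := hq
  rw [riesz_add, riesz_sum, riesz_sum]
  refine add_nonneg (Finset.sum_nonneg fun i _ => hy.1 _ (hq₀ i)) (Finset.sum_nonneg fun j _ => ?_)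
  obtain ⟨M, q', hq', h⟩ := hp j
  rw [h, Finset.mul_sum, riesz_sum]
  exact Finset.sum_nonneg fun i _ => hy.2 j _ (hq' i)

lemma halfDeg_le_minOrder (g : Fin nX → MvPolynomial (Fin n) ℝ) (j : Fin nX) :
    halfDeg (g j) ≤ minOrder g :=
  le_max_of_le_right (Finset.le_sup (f := fun j => halfDeg (g j)) (Finset.mem_univ j))

lemma totalDegree_le_two_mul_halfDeg (p : MvPolynomial (Fin n) ℝ) :
    p.totalDegree ≤ 2 * halfDeg p := by
  unfold halfDeg; omega

lemma totalDegree_sq_le {q : MvPolynomial (Fin n) ℝ} (hq : q.totalDegree ≤ r) :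
    (q ^ 2).totalDegree ≤ 2 * r :=
  (totalDegree_pow _ _).trans (Nat.mul_le_mul_left 2 hq)

/-- The degree bound guarantees that `riesz`, which ignores coefficients of order above `2k`, sees
the whole polynomial. -/
lemma totalDegree_mul_sq_le {g : Fin nX → MvPolynomial (Fin n) ℝ} (hk : minOrder g ≤ k)
    (j : Fin nX) {q : MvPolynomial (Fin n) ℝ} (hq : q.totalDegree ≤ k - halfDeg (g j)) :
    (g j * q ^ 2).totalDegree ≤ 2 * k := by
  have h1 := totalDegree_mul (g j) (q ^ 2)
  have h2 := totalDegree_sq_le hq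
  have h3 := totalDegree_le_two_mul_halfDeg (g j)
  have h4 := (halfDeg_le_minOrder g j).trans hk
  omega

lemma totalDegree_le_of_mem_quadModule {g : Fin nX → MvPolynomial (Fin n) ℝ}
    (hk : minOrder g ≤ k) {q : MvPolynomial (Fin n) ℝ} (hq : q ∈ quadModule g k) :
    q.totalDegree ≤ 2 * k := by
  obtain ⟨p₀, ⟨N, q₀, hq₀, rfl⟩, p, hp, rfl⟩ := hq
  refine (totalDegree_add _ _).trans (max_le ?_ ?_)
  · exact totalDegree_finsetSum_le fun i _ => totalDegree_sq_le (hq₀ i)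
  · refine totalDegree_finsetSum_le fun j _ => ?_
    obtain ⟨M, q', hq', h⟩ := hp j
    rw [h, Finset.mul_sum]
    exact totalDegree_finsetSum_le fun i _ => totalDegree_mul_sq_le hk j (hq' i)

lemma eval_nonneg_of_mem_quadModule {g : Fin nX → MvPolynomial (Fin n) ℝ}
    {q : MvPolynomial (Fin n) ℝ} (hq : q ∈ quadModule g k) {x : Fin n → ℝ}
    (hx : x ∈ semialgSet g) : 0 ≤ eval x q := by
  obtain ⟨p₀, ⟨N, q₀, hq₀, rfl⟩, p, hp, rfl⟩ := hq
  simp only [map_add, map_sum, map_pow, map_mul]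
  refine add_nonneg (Finset.sum_nonneg fun i _ => sq_nonneg _) (Finset.sum_nonneg fun j _ => ?_)
  obtain ⟨M, q', hq', h⟩ := hp j
  rw [h, map_sum]
  refine mul_nonneg (hx j) (Finset.sum_nonneg fun i _ => ?_)
  rw [map_pow]
  exact sq_nonneg _

lemma totalDegree_lincomb_le {d : ℕ} {a : Fin m → MvPolynomial (Fin n) ℝ}
    (ha : ∀ i, (a i).totalDegree ≤ d) (u : Fin m → ℝ) : (lincomb a u).totalDegree ≤ d :=
  totalDegree_finsetSum_le fun i _ => by
    rw [← smul_eq_C_mul]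
    exact (totalDegree_smul_le _ _).trans (ha i)

end MomentSOS

/-! ### The GNS construction for a flat functional. -/

namespace MomentSOS

variable {n nX m r s k : ℕ}

section GNS

variable {H : Type*} [NormedAddCommGroup H] [InnerProductSpace ℝ H]

lemma totalDegree_X_mul_le {p : MvPolynomial (Fin n) ℝ} {i : Fin n} (hp : p.totalDegree < k) :
    (X i * p).totalDegree ≤ k := by
  have := totalDegree_mul (X i) p
  rw [totalDegree_X] at this
  omega

/-- In the GNS space of a flat functional the variables act by commuting symmetric operators. -/
lemma exists_multiplication_operators (Φ : MvPolynomial (Fin n) ℝ →ₗ[ℝ] H)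
    (ℓ : MvPolynomial (Fin n) ℝ →ₗ[ℝ] ℝ) (hsk : s < k)
    (hΦ : ∀ p q : MvPolynomial (Fin n) ℝ, p.totalDegree ≤ k → q.totalDegree ≤ k →
      inner ℝ (Φ p) (Φ q) = ℓ (p * q))
    (hsurj : ∀ h, ∃ q : MvPolynomial (Fin n) ℝ, q.totalDegree ≤ s ∧ Φ q = h) :
    ∃ T : Fin n → H →ₗ[ℝ] H, (∀ i, (T i).IsSymmetric) ∧ (∀ i j, Commute (T i) (T j)) ∧
      ∀ i, ∀ p : MvPolynomial (Fin n) ℝ, p.totalDegree < k → T i (Φ p) = Φ (X i * p) := by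
  -- The kernel is stable under `X i`, so multiplication is well defined. Flatness enters here: `Φ
  -- (X i * κ)` has a representative `q` of degree at most `s < k`, so `X i` can be moved from `κ`
  -- to `q` without exceeding degree `k`.
  have hker : ∀ i, ∀ κ : MvPolynomial (Fin n) ℝ, κ.totalDegree < k → Φ κ = 0 →
      Φ (X i * κ) = 0 := by
    intro i κ hκ h0
    rw [← inner_self_eq_zero (𝕜 := ℝ)]
    obtain ⟨q, hq, h⟩ := hsurj (Φ (X i * κ))
    nth_rewrite 2 [← h]
    rw [hΦ _ _ (totalDegree_X_mul_le hκ) (by omega), mul_comm (X i) κ, mul_assoc,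
      ← hΦ _ _ hκ.le (totalDegree_X_mul_le (by omega)), h0, inner_zero_left]
  -- A linear section choosing representatives of degree at most `s`, which leaves room for one more
  -- factor `X i`.
  obtain ⟨σ, hσ⟩ := (Φ.domRestrict (restrictTotalDegree (Fin n) ℝ s)).exists_rightInverse_of_surjective
    (LinearMap.range_eq_top.2 fun h => by
      obtain ⟨q, hq, rfl⟩ := hsurj h
      exact ⟨⟨q, (mem_restrictTotalDegree _ _ _).2 hq⟩, rfl⟩)
  have hσdeg : ∀ h, (σ h).1.totalDegree < k := fun h =>
    ((mem_restrictTotalDegree _ _ _).1 (σ h).2).trans_lt hsk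
  have hσΦ : ∀ h, Φ (σ h).1 = h := fun h => LinearMap.congr_fun hσ h
  let T : Fin n → H →ₗ[ℝ] H := fun i =>
    Φ ∘ₗ LinearMap.mulLeft ℝ (X i) ∘ₗ (restrictTotalDegree (Fin n) ℝ s).subtype ∘ₗ σ
  have hTdef : ∀ i h, T i h = Φ (X i * (σ h).1) := fun i h => rfl
  have hT : ∀ i, ∀ p : MvPolynomial (Fin n) ℝ, p.totalDegree < k → T i (Φ p) = Φ (X i * p) := by
    intro i p hp
    rw [hTdef, ← sub_eq_zero, ← map_sub, ← mul_sub]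
    refine hker i _ ((totalDegree_sub _ _).trans_lt (max_lt (hσdeg _) hp)) ?_
    rw [map_sub, hσΦ, sub_self]
  have hsymm : ∀ i, (T i).IsSymmetric := by
    intro i x z
    obtain ⟨p, hp, rfl⟩ := hsurj x
    obtain ⟨q, hq, rfl⟩ := hsurj z
    rw [hT i p (by omega), hT i q (by omega),
      hΦ _ _ (totalDegree_X_mul_le (by omega)) (by omega),
      hΦ _ _ (by omega) (totalDegree_X_mul_le (by omega))]
    congr 1
    ring
  refine ⟨T, hsymm, fun i j => ?_, hT⟩
  -- Symmetry puts one variable on each side of the inner product, so no argument of `Φ` has degree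
  -- above `s + 1 ≤ k`.
  refine LinearMap.ext fun x => ext_inner_right ℝ fun z => ?_
  simp only [Module.End.mul_apply]
  rw [hsymm i (T j x) z, hsymm j (T i x) z]
  obtain ⟨p, hp, rfl⟩ := hsurj x
  obtain ⟨q, hq, rfl⟩ := hsurj z
  rw [hT i p (by omega), hT i q (by omega), hT j p (by omega), hT j q (by omega),
      hΦ _ _ (totalDegree_X_mul_le (by omega)) (totalDegree_X_mul_le (by omega)),
      hΦ _ _ (totalDegree_X_mul_le (by omega)) (totalDegree_X_mul_le (by omega))]
  congr 1
  ring

/-- If `Φ 1` is a sum of joint eigenvectors of the multiplication operators, then `Φ p` is obtained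
by evaluating `p` at the joint eigenvalues. -/
lemma map_eq_sum_eval_smul (Φ : MvPolynomial (Fin n) ℝ →ₗ[ℝ] H) (T : Fin n → H →ₗ[ℝ] H)
    (hT : ∀ i, ∀ p : MvPolynomial (Fin n) ℝ, p.totalDegree < k → T i (Φ p) = Φ (X i * p))
    (S : Finset (Fin n → ℝ)) (f : (Fin n → ℝ) → H) (hf : ∀ x i, T i (f x) = x i • f x)
    (h1 : Φ 1 = ∑ x ∈ S, f x) {p : MvPolynomial (Fin n) ℝ} (hp : p.totalDegree ≤ k) :
    Φ p = ∑ x ∈ S, eval x p • f x := by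
  let Ψ : MvPolynomial (Fin n) ℝ →ₗ[ℝ] H :=
    ∑ x ∈ S, LinearMap.toSpanSingleton ℝ H (f x) ∘ₗ (aeval x).toLinearMap
  have hΨ : ∀ q, Ψ q = ∑ x ∈ S, eval x q • f x := fun q => by
    simp [Ψ, aeval_eq_eval]
  rw [← hΨ]
  refine linearMap_eq_of_monomial (s := k) ?_ hp
  -- Peeling off one variable at a time reaches degree `k`, although `hT` applies only to
  -- polynomials of degree below `k`.
  suffices ∀ d ≤ k, ∀ α : Fin n →₀ ℕ, α.degree = d → Φ (monomial α 1) = Ψ (monomial α 1) from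
    fun α hα => this _ hα α rfl
  intro d
  induction d with
  | zero =>
    intro _ α hα
    rw [Finsupp.degree_eq_zero_iff] at hα
    subst hα
    rw [hΨ, show (monomial (0 : Fin n →₀ ℕ) (1 : ℝ)) = 1 from rfl, h1]
    simp
  | succ d ih =>
    intro hd α hα
    obtain ⟨i, hi⟩ : ∃ i, α i ≠ 0 := by
      by_contra! h
      have : α = 0 := Finsupp.ext h
      simp [this] at hα
    have hα' : α = Finsupp.single i 1 + (α - Finsupp.single i 1) := by
      rw [add_tsub_cancel_of_le]
      simpa [Nat.one_le_iff_ne_zero] using hi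
    set β := α - Finsupp.single i 1
    have hβ : β.degree = d := by
      have := congrArg Finsupp.degree hα'
      rw [map_add, Finsupp.degree_single, hα] at this
      omega
    have hm : monomial α (1 : ℝ) = X i * monomial β 1 := by
      rw [X, monomial_mul, mul_one, ← hα']
    rw [hm, ← hT i _ ((totalDegree_monomial_le' β 1).trans_lt (by omega)), ih (by omega) β hβ, hΨ,
      hΨ, map_sum]
    refine Finset.sum_congr rfl fun x _ => ?_
    rw [map_smul, hf, smul_smul, map_mul, eval_X, mul_comm]

variable [FiniteDimensional ℝ H]

/-- A functional whose GNS space is spanned by polynomials of lower degree is a positive combination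
of point evaluations, and these points admit interpolation polynomials of lower degree. -/
theorem exists_atoms_of_gns (Φ : MvPolynomial (Fin n) ℝ →ₗ[ℝ] H)
    (ℓ : MvPolynomial (Fin n) ℝ →ₗ[ℝ] ℝ) (hsk : s < k)
    (hΦ : ∀ p q : MvPolynomial (Fin n) ℝ, p.totalDegree ≤ k → q.totalDegree ≤ k →
      inner ℝ (Φ p) (Φ q) = ℓ (p * q))
    (hsurj : ∀ h, ∃ q : MvPolynomial (Fin n) ℝ, q.totalDegree ≤ s ∧ Φ q = h) :
    ∃ (S : Finset (Fin n → ℝ)) (w : (Fin n → ℝ) → ℝ), (∀ x ∈ S, 0 < w x) ∧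
      (∀ p q : MvPolynomial (Fin n) ℝ, p.totalDegree ≤ k → q.totalDegree ≤ k →
        ℓ (p * q) = ∑ x ∈ S, w x * (eval x p * eval x q)) ∧
      ∀ x ∈ S, ∃ q : MvPolynomial (Fin n) ℝ, q.totalDegree ≤ s ∧ eval x q = 1 ∧
        ∀ z ∈ S, z ≠ x → eval z q = 0 := by
  obtain ⟨T, hsymm, hcomm, hT⟩ := exists_multiplication_operators Φ ℓ hsk hΦ hsurj
  -- Simultaneous diagonalization; a tuple of joint eigenvalues is a point of `ℝⁿ`.
  have htop := LinearMap.IsSymmetric.iSup_iInf_eq_top_of_commute hsymm fun i j _ => hcomm i j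
  have hmem : Φ 1 ∈ ⨆ χ : Fin n → ℝ, ⨅ i, Module.End.eigenspace (T i) (χ i) := by
    rw [htop]; trivial
  rw [Submodule.mem_iSup_iff_exists_finsupp] at hmem
  obtain ⟨f, hf, hsum⟩ := hmem
  have hfT : ∀ x i, T i (f x) = x i • f x := fun x i =>
    Module.End.mem_eigenspace_iff.1 (Submodule.mem_iInf _ |>.1 (hf x) i)
  have horth : ∀ x z, x ≠ z → inner ℝ (f x) (f z) = 0 := fun x z hxz =>
    LinearMap.IsSymmetric.orthogonalFamily_iInf_eigenspaces hsymm hxz ⟨f x, hf x⟩ ⟨f z, hf z⟩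
  have hΦf : ∀ p : MvPolynomial (Fin n) ℝ, p.totalDegree ≤ k →
      Φ p = ∑ x ∈ f.support, eval x p • f x := fun p hp =>
    map_eq_sum_eval_smul Φ T hT f.support f hfT hsum.symm hp
  have hinner : ∀ p : MvPolynomial (Fin n) ℝ, p.totalDegree ≤ k → ∀ z ∈ f.support,
      inner ℝ (Φ p) (f z) = eval z p * inner ℝ (f z) (f z) := by
    intro p hp z hz
    rw [hΦf p hp, sum_inner, Finset.sum_eq_single_of_mem z hz, real_inner_smul_left]
    intro x _ hxz
    rw [real_inner_smul_left, horth x z hxz, mul_zero]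
  have hpos : ∀ x ∈ f.support, 0 < inner ℝ (f x) (f x) := fun x hx =>
    real_inner_self_pos.2 (Finsupp.mem_support_iff.1 hx)
  refine ⟨f.support, fun x => inner ℝ (f x) (f x), hpos, fun p q hp hq => ?_, fun x hx => ?_⟩
  · rw [← hΦ p q hp hq]
    nth_rewrite 1 [hΦf q hq]
    rw [inner_sum]
    refine Finset.sum_congr rfl fun x hx => ?_
    rw [real_inner_smul_right, hinner p hp x hx]
    ring
  -- By `hinner`, the inner product of `Φ q` with `f z` is `q(z)‖f z‖²`. A preimage of `f x`
  -- therefore takes the value `1` at `x` and, by orthogonality, `0` at the other atoms.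
  · obtain ⟨q, hq, hqx⟩ := hsurj (f x)
    refine ⟨q, hq, ?_, fun z hz hzx => ?_⟩
    · have := hinner q (by omega) x hx
      rw [hqx] at this
      exact mul_right_cancel₀ (hpos x hx).ne' (by rw [← this, one_mul])
    · have := hinner q (by omega) z hz
      rw [hqx, horth x z hzx.symm, eq_comm, mul_eq_zero] at this
      exact this.resolve_right (hpos z hz).ne'

end GNS

end MomentSOS

/-! ### Flat extension for moment matrices. -/

namespace MomentSOS

variable {n nX m r s k : ℕ}

open scoped MatrixOrder in
lemma _root_.Matrix.PosSemidef.exists_eq_transpose_mul_self {ι : Type*} [Fintype ι]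
    {M : Matrix ι ι ℝ} (hM : M.PosSemidef) : ∃ B : Matrix ι ι ℝ, M = B.transpose * B := by
  classical
  obtain ⟨B, h⟩ := CStarAlgebra.nonneg_iff_eq_star_mul_self.mp hM.nonneg
  exact ⟨B, by rw [h, Matrix.star_eq_conjTranspose, Matrix.conjTranspose_eq_transpose_of_trivial]⟩

/-- The inclusion of the monomial basis of `ℝ[x]_s` into that of `ℝ[x]_k`. -/
def monIdxIncl (n : ℕ) (hsk : s ≤ k) (α : MonIdx n s) : MonIdx n k := ⟨α.1, α.2.trans hsk⟩

lemma momMatrix_eq_submatrix (hsk : s ≤ k) (y : MonIdx n r → ℝ) :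
    momMatrix s y = (momMatrix k y).submatrix (monIdxIncl n hsk) (monIdxIncl n hsk) := rfl

lemma submatrix_mulVec_eq {ι : Type*} (hsk : s ≤ k) (B : Matrix ι (MonIdx n k) ℝ)
    (w : MonIdx n s → ℝ) :
    (B.submatrix id (monIdxIncl n hsk)).mulVec w = B.mulVec (coeffVec n k (toPoly w)) := by
  classical
  ext i
  simp only [Matrix.mulVec, dotProduct, Matrix.submatrix_apply, id_eq, coeffVec_apply,
    toPoly_apply, coeff_sum, coeff_monomial, Finset.mul_sum]
  rw [Finset.sum_comm]
  refine Finset.sum_congr rfl fun α _ => ?_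
  rw [Finset.sum_eq_single (monIdxIncl n hsk α)]
  · simp [monIdxIncl]
  · intro β _ hβ
    rw [if_neg fun h => hβ (Subtype.ext h.symm), mul_zero]
  · simp

/-- If the rank of the moment matrix does not grow from order `s` to order `k`, then every column
combination of a factor of the moment matrix comes from a polynomial of degree at most `s`. -/
lemma exists_totalDegree_le_of_rank_eq (hsk : s ≤ k) {y : MonIdx n r → ℝ}
    {B : Matrix (MonIdx n k) (MonIdx n k) ℝ} (hB : momMatrix k y = B.transpose * B)
    (hrank : (momMatrix s y).rank = (momMatrix k y).rank) (v : MonIdx n k → ℝ) :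
    ∃ q : MvPolynomial (Fin n) ℝ, q.totalDegree ≤ s ∧ B.mulVec (coeffVec n k q) = B.mulVec v := by
  set B' := B.submatrix id (monIdxIncl n hsk) with hB'
  have hMs : momMatrix s y = B'.transpose * B' := by
    rw [momMatrix_eq_submatrix hsk, hB, hB', Matrix.transpose_submatrix,
      Matrix.submatrix_mul _ _ _ id _ Function.bijective_id]
  have hle : LinearMap.range B'.mulVecLin ≤ LinearMap.range B.mulVecLin := by
    rintro _ ⟨w, rfl⟩
    exact ⟨coeffVec n k (toPoly w), (submatrix_mulVec_eq hsk B w).symm⟩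
  have heq : LinearMap.range B'.mulVecLin = LinearMap.range B.mulVecLin := by
    refine Submodule.eq_of_le_of_finrank_eq hle ?_
    rw [hMs, hB, Matrix.rank_transpose_mul_self, Matrix.rank_transpose_mul_self] at hrank
    exact hrank
  obtain ⟨w, hw⟩ : B.mulVec v ∈ LinearMap.range B'.mulVecLin := heq ▸ ⟨v, rfl⟩
  exact ⟨toPoly w, totalDegree_toPoly_le w, by rw [← submatrix_mulVec_eq hsk]; exact hw⟩

/-- Every moment of order at most `2k` is thus an entry of the moment matrix of order `k`. -/
lemma exists_add_eq_of_degree_le {α : Fin n →₀ ℕ} (hα : α.degree ≤ 2 * k) :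
    ∃ β γ : Fin n →₀ ℕ, β.degree ≤ k ∧ γ.degree ≤ k ∧ α = β + γ := by
  by_cases h : α.degree ≤ k
  · exact ⟨α, 0, h, by simp, by simp⟩
  · obtain ⟨β, hβ, hd⟩ := Finsupp.exists_le_degree_eq α k (by omega)
    refine ⟨β, α - β, hd.le, ?_, (add_tsub_cancel_of_le hβ).symm⟩
    have := congrArg Finsupp.degree (add_tsub_cancel_of_le hβ)
    rw [map_add] at this
    omega

/-- Flat moment matrices come from finitely many atoms with interpolation polynomials of low
degree. -/
theorem exists_atoms_of_rank_eq (hsk : s < k) {y : MonIdx n (2 * k) → ℝ}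
    (hy : (momMatrix k y).PosSemidef) (hrank : (momMatrix s y).rank = (momMatrix k y).rank) :
    ∃ (S : Finset (Fin n → ℝ)) (w : (Fin n → ℝ) → ℝ), (∀ x ∈ S, 0 < w x) ∧
      (∀ p : MvPolynomial (Fin n) ℝ, p.totalDegree ≤ 2 * k →
        riesz y p = ∑ x ∈ S, w x * eval x p) ∧
      ∀ x ∈ S, ∃ q : MvPolynomial (Fin n) ℝ, q.totalDegree ≤ s ∧ eval x q = 1 ∧
        ∀ z ∈ S, z ≠ x → eval z q = 0 := by
  obtain ⟨B, hB⟩ := hy.exists_eq_transpose_mul_self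
  -- The GNS map is `p ↦ B p`, taken onto its range; its Gram form is `BᵀB = M_k(y)`.
  let Φ₀ : MvPolynomial (Fin n) ℝ →ₗ[ℝ] EuclideanSpace ℝ (MonIdx n k) :=
    (WithLp.linearEquiv 2 ℝ (MonIdx n k → ℝ)).symm.toLinearMap ∘ₗ B.mulVecLin ∘ₗ coeffVec n k
  have hΦ₀ : ∀ p, Φ₀ p = WithLp.toLp 2 (B.mulVec (coeffVec n k p)) := fun p => rfl
  obtain ⟨S, w, hw, hsum, hq⟩ := exists_atoms_of_gns Φ₀.rangeRestrict (rieszLin y) hsk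
    (fun p q hp hq => by
      change inner ℝ (Φ₀ p) (Φ₀ q) = _
      rw [hΦ₀, hΦ₀, EuclideanSpace.inner_toLp_toLp, star_trivial, dotProduct_comm,
        ← Matrix.vecMul_transpose, ← Matrix.dotProduct_mulVec, Matrix.mulVec_mulVec, ← hB,
        momMatrix, dotProduct_locMatrix_mulVec, toPoly_coeffVec hp, toPoly_coeffVec hq, one_mul,
        rieszLin_apply])
    (fun h => by
      obtain ⟨_, p, rfl⟩ := h
      obtain ⟨q, hq, h⟩ := exists_totalDegree_le_of_rank_eq hsk.le hB hrank (coeffVec n k p)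
      refine ⟨q, hq, Subtype.ext ?_⟩
      change Φ₀ q = Φ₀ p
      rw [hΦ₀, hΦ₀, h])
  refine ⟨S, w, hw, fun p hp => ?_, hq⟩
  let Ψ : MvPolynomial (Fin n) ℝ →ₗ[ℝ] ℝ := ∑ x ∈ S, w x • (aeval x).toLinearMap
  have hΨ : ∀ q, Ψ q = ∑ x ∈ S, w x * eval x q := fun q => by
    simp [Ψ, aeval_eq_eval]
  rw [← hΨ, ← rieszLin_apply]
  refine linearMap_eq_of_monomial (fun α hα => ?_) hp
  obtain ⟨β, γ, hβ, hγ, rfl⟩ := exists_add_eq_of_degree_le hα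
  have hmul : monomial (β + γ) (1 : ℝ) = monomial β 1 * monomial γ 1 := by
    rw [monomial_mul, one_mul]
  rw [hmul, hsum _ _ ((totalDegree_monomial_le' β 1).trans hβ)
    ((totalDegree_monomial_le' γ 1).trans hγ), hΨ]
  simp only [map_mul]

/-- A moment matrix of finitely many interpolated atoms has rank the number of atoms. -/
lemma rank_momMatrix_eq_card {y : MonIdx n (2 * k) → ℝ} {S : Finset (Fin n → ℝ)}
    {w : (Fin n → ℝ) → ℝ} (hw : ∀ x ∈ S, 0 < w x)
    (hsum : ∀ p : MvPolynomial (Fin n) ℝ, p.totalDegree ≤ 2 * k →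
      riesz y p = ∑ x ∈ S, w x * eval x p)
    (hq : ∀ x ∈ S, ∃ q : MvPolynomial (Fin n) ℝ, q.totalDegree ≤ k ∧ eval x q = 1 ∧
        ∀ z ∈ S, z ≠ x → eval z q = 0) :
    (momMatrix k y).rank = S.card := by
  classical
  -- A weighted Vandermonde matrix with `M_k(y) = NᵀN`. The interpolation polynomials make it
  -- surjective onto functions on `S`, so its rank is the number of atoms.
  let N : Matrix S (MonIdx n k) ℝ :=
    Matrix.of fun x α => Real.sqrt (w x.1) * eval x.1 (monomial α.1 (1 : ℝ))
  have hN : ∀ x α, N x α = Real.sqrt (w x.1) * eval x.1 (monomial α.1 (1 : ℝ)) := fun _ _ => rfl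
  have hMN : momMatrix k y = N.transpose * N := by
    ext α β
    have hdeg : (monomial α.1 (1 : ℝ) * monomial β.1 1).totalDegree ≤ 2 * k := by
      have h1 := (totalDegree_monomial_le' α.1 1).trans α.2
      have h2 := (totalDegree_monomial_le' β.1 1).trans β.2
      have := totalDegree_mul (monomial α.1 (1 : ℝ)) (monomial β.1 1)
      omega
    change riesz y (1 * (monomial α.1 1 * monomial β.1 1)) = _
    rw [one_mul, hsum _ hdeg, Matrix.mul_apply, ← Finset.sum_coe_sort S]
    refine Finset.sum_congr rfl fun x _ => ?_
    rw [Matrix.transpose_apply, hN, hN, map_mul]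
    nth_rewrite 1 [← Real.mul_self_sqrt (hw x.1 x.2).le]
    ring
  have hNp : ∀ (p : MvPolynomial (Fin n) ℝ), p.totalDegree ≤ k → ∀ x : S,
      N.mulVec (coeffVec n k p) x = Real.sqrt (w x.1) * eval x.1 p := by
    intro p hp x
    nth_rewrite 2 [← toPoly_coeffVec hp]
    rw [toPoly_apply, map_sum, Finset.mul_sum]
    refine Finset.sum_congr rfl fun α _ => ?_
    have : monomial α.1 (coeffVec n k p α) = coeffVec n k p α • monomial α.1 (1 : ℝ) := by
      rw [smul_monomial, smul_eq_mul, mul_one]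
    change N x α * coeffVec n k p α = _
    rw [hN, this, smul_eval]
    ring
  have hsurj : LinearMap.range N.mulVecLin = ⊤ := by
    rw [LinearMap.range_eq_top]
    intro v
    choose q hqd hq1 hq0 using fun x : S => hq x.1 x.2
    refine ⟨coeffVec n k (∑ x : S, (v x / Real.sqrt (w x.1)) • q x), funext fun z => ?_⟩
    rw [Matrix.mulVecLin_apply, hNp _ (totalDegree_finsetSum_le fun x _ =>
      (totalDegree_smul_le _ _).trans (hqd x)), map_sum, Finset.sum_eq_single z]
    · rw [smul_eval, hq1, mul_one, mul_div_cancel₀ _ (Real.sqrt_pos.2 (hw z.1 z.2)).ne']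
    · intro x _ hxz
      rw [smul_eval, hq0 x z.1 z.2 fun h => hxz (Subtype.ext h.symm), mul_zero]
    · simp
  rw [hMN, Matrix.rank_transpose_mul_self, Matrix.rank, hsurj, finrank_top]
  simp

/-- The flat extension theorem: a flat element of the truncated moment cone is represented by
finitely many atoms in the semialgebraic set. -/
theorem exists_atoms_of_flat {g : Fin nX → MvPolynomial (Fin n) ℝ} (hk : minOrder g ≤ k)
    {y : MonIdx n (2 * k) → ℝ} (hy : y ∈ momCone g k)
    (hrank : (momMatrix (k - minOrder g) y).rank = (momMatrix k y).rank) :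
    ∃ (S : Finset (Fin n → ℝ)) (w : (Fin n → ℝ) → ℝ), (∀ x ∈ S, 0 < w x) ∧
      (∀ p : MvPolynomial (Fin n) ℝ, p.totalDegree ≤ 2 * k →
        riesz y p = ∑ x ∈ S, w x * eval x p) ∧
      (∀ x ∈ S, ∃ q : MvPolynomial (Fin n) ℝ, q.totalDegree < k ∧ eval x q = 1 ∧
        ∀ z ∈ S, z ≠ x → eval z q = 0) ∧
      (S : Set (Fin n → ℝ)) ⊆ semialgSet g ∧ S.card = (momMatrix k y).rank := by
  -- The `1` in the maximum defining `k_X` makes `k - k_X` strictly smaller than `k`.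
  have h1 : 1 ≤ minOrder g := le_max_left _ _
  obtain ⟨S, w, hw, hsum, hq⟩ := exists_atoms_of_rank_eq (by omega) hy.1 hrank
  refine ⟨S, w, hw, hsum, fun x hx => ?_, fun x hx j => ?_, ?_⟩
  · obtain ⟨q, hqd, h⟩ := hq x hx
    exact ⟨q, by omega, h⟩
  · obtain ⟨q, hqd, hq1, hq0⟩ := hq x hx
    have hj := halfDeg_le_minOrder g j
    have hqd' : q.totalDegree ≤ k - halfDeg (g j) := by omega
    -- Testing the localizing matrix on the interpolation polynomial at `x` leaves the single term
    -- `w x * g_j(x)`. Its degree is admissible because `k - k_X ≤ k - k_j`.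
    have := (mem_momCone_iff.1 hy).2 j q hqd'
    rw [hsum _ (totalDegree_mul_sq_le hk j hqd'), Finset.sum_eq_single_of_mem x hx] at this
    · rw [map_mul, map_pow, hq1, one_pow, mul_one] at this
      exact nonneg_of_mul_nonneg_right this (hw x hx)
    · intro z hz hzx
      rw [map_mul, map_pow, hq0 z hz hzx]
      ring
  · refine (rank_momMatrix_eq_card hw hsum fun x hx => ?_).symm
    obtain ⟨q, hqd, h⟩ := hq x hx
    exact ⟨q, by omega, h⟩

end MomentSOS

/-! ### Representing measures, their moments and their supports. -/

namespace MomentSOS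

variable {n nX m r s k : ℕ}

lemma isClosed_semialgSet (g : Fin nX → MvPolynomial (Fin n) ℝ) : IsClosed (semialgSet g) := by
  have : semialgSet g = ⋂ j, {x | 0 ≤ eval x (g j)} := by
    ext x
    simp [semialgSet]
  rw [this]
  exact isClosed_iInter fun j => isClosed_le continuous_const (g j).continuous_eval

lemma isCompact_semialgSet_of_ballPoly {g : Fin nX → MvPolynomial (Fin n) ℝ} {R : ℝ}
    (h : ∀ x ∈ semialgSet g, 0 ≤ eval x (ballPoly n R)) : IsCompact (semialgSet g) := by
  refine Metric.isCompact_of_isClosed_isBounded (isClosed_semialgSet g) ?_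
  refine (Metric.isBounded_closedBall (x := (0 : Fin n → ℝ)) (r := |R|)).subset fun x hx => ?_
  rw [mem_closedBall_zero_iff, pi_norm_le_iff_of_nonneg (abs_nonneg R)]
  intro i
  have h1 := h x hx
  simp only [ballPoly, map_sub, map_sum, map_pow, eval_C, eval_X] at h1
  have h2 : x i ^ 2 ≤ ∑ i, x i ^ 2 :=
    Finset.single_le_sum (f := fun i => x i ^ 2) (fun j _ => sq_nonneg _) (Finset.mem_univ i)
  exact sq_le_sq.1 (by linarith)

lemma isCompact_semialgSet {g : Fin nX → MvPolynomial (Fin n) ℝ}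
    (hX : (∃ (j : Fin nX) (R : ℝ), g j = ballPoly n R) ∨ IsArchimedean g) :
    IsCompact (semialgSet g) := by
  obtain ⟨j, R, h⟩ | ⟨R, k, -, h⟩ := hX
  · exact isCompact_semialgSet_of_ballPoly fun x hx => h ▸ hx j
  · exact isCompact_semialgSet_of_ballPoly fun x hx => eval_nonneg_of_mem_quadModule h hx

section Integration

variable {K : Set (Fin n → ℝ)} {μ : Measure (Fin n → ℝ)}

lemma IsMeasureOn.ae_mem (hμ : IsMeasureOn K μ) : ∀ᵐ x ∂μ, x ∈ K := hμ.2

lemma IsMeasureOn.integrable_eval (hK : IsCompact K) (hμ : IsMeasureOn K μ)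
    (p : MvPolynomial (Fin n) ℝ) : Integrable (fun x => eval x p) μ := by
  have := hμ.1
  have h := (p.continuous_eval.continuousOn (s := K)).integrableOn_compact (μ := μ) hK
  rwa [IntegrableOn, Measure.restrict_eq_self_of_ae_mem hμ.ae_mem] at h

/-- The sequence of moments of order at most `s`. -/
noncomputable def momentSeq (n s : ℕ) (μ : Measure (Fin n → ℝ)) (α : MonIdx n s) : ℝ :=
  ∫ x, eval x (monomial α.1 (1 : ℝ)) ∂μ

lemma riesz_momentSeq (hK : IsCompact K) (hμ : IsMeasureOn K μ) {p : MvPolynomial (Fin n) ℝ}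
    (hp : p.totalDegree ≤ s) : riesz (momentSeq n s μ) p = ∫ x, eval x p ∂μ := by
  have h : ∀ x, eval x p = ∑ α : MonIdx n s, coeff α.1 p * eval x (monomial α.1 (1 : ℝ)) := by
    intro x
    nth_rewrite 1 [← toPoly_coeffVec hp]
    rw [toPoly_apply, map_sum]
    refine Finset.sum_congr rfl fun α _ => ?_
    rw [eval_monomial, eval_monomial, one_mul, coeffVec_apply]
  simp only [h]
  rw [integral_finsetSum _ fun α _ => (hμ.integrable_eval hK _).const_mul _]
  simp only [integral_const_mul]
  rfl

lemma Represents.eq_momentSeq {y : MonIdx n s → ℝ} (h : Represents K y μ) :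
    y = momentSeq n s μ := funext h.2

lemma Represents.riesz_eq_integral (hK : IsCompact K) {y : MonIdx n s → ℝ}
    (h : Represents K y μ) {p : MvPolynomial (Fin n) ℝ} (hp : p.totalDegree ≤ s) :
    riesz y p = ∫ x, eval x p ∂μ := by
  rw [h.eq_momentSeq, riesz_momentSeq hK h.1 hp]

lemma momentSeq_mem_momCone {g : Fin nX → MvPolynomial (Fin n) ℝ} (hk : minOrder g ≤ k)
    (hK : IsCompact (semialgSet g)) (hμ : IsMeasureOn (semialgSet g) μ) :
    momentSeq n (2 * k) μ ∈ momCone g k := by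
  refine mem_momCone_iff.2 ⟨fun q hq => ?_, fun j q hq => ?_⟩
  · rw [riesz_momentSeq hK hμ (totalDegree_sq_le hq)]
    refine integral_nonneg fun x => ?_
    rw [map_pow]
    exact sq_nonneg _
  · rw [riesz_momentSeq hK hμ (totalDegree_mul_sq_le hk j hq)]
    refine integral_nonneg_of_ae (hμ.ae_mem.mono fun x hx => ?_)
    simp only [map_mul, map_pow]
    exact mul_nonneg (hx j) (sq_nonneg _)

lemma eval_eq_zero_of_mem_support {p : MvPolynomial (Fin n) ℝ}
    (h : ∀ᵐ x ∂μ, eval x p = 0) {x : Fin n → ℝ} (hx : x ∈ μ.support) : eval x p = 0 :=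
  Measure.support_subset_of_isClosed (t := {x | eval x p = 0})
    (isClosed_eq p.continuous_eval continuous_const) h hx

/-- A nonnegative integrand with zero integral vanishes almost everywhere, and the zero set of a
polynomial is closed, so it contains the support. -/
lemma eval_eq_zero_of_integral_eq_zero (hK : IsCompact K) (hμ : IsMeasureOn K μ)
    {p : MvPolynomial (Fin n) ℝ} (hp : ∀ x ∈ K, 0 ≤ eval x p) (h : ∫ x, eval x p ∂μ = 0)
    {x : Fin n → ℝ} (hx : x ∈ μ.support) : eval x p = 0 :=
  eval_eq_zero_of_mem_support ((integral_eq_zero_iff_of_nonneg_ae (hμ.ae_mem.mono fun x => hp x)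
    (hμ.integrable_eval hK p)).1 h) hx

/-- A finite combination of Dirac measures represents its moments. -/
lemma exists_represents_of_atoms {y : MonIdx n s → ℝ} {S : Finset (Fin n → ℝ)}
    {w : (Fin n → ℝ) → ℝ} (hw : ∀ x ∈ S, 0 < w x)
    (hsum : ∀ p : MvPolynomial (Fin n) ℝ, p.totalDegree ≤ s →
      riesz y p = ∑ x ∈ S, w x * eval x p)
    (hSK : (S : Set (Fin n → ℝ)) ⊆ K) : ∃ μ, Represents K y μ := by
  refine ⟨∑ x ∈ S, ENNReal.ofReal (w x) • Measure.dirac x, ⟨⟨?_⟩, ?_⟩, fun α => ?_⟩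
  · simp [Measure.finsetSum_apply]
  · rw [Measure.finsetSum_apply]
    refine Finset.sum_eq_zero fun x hx => ?_
    rw [Measure.smul_apply, Measure.dirac_apply]
    simp [hSK hx]
  · rw [← riesz_monomial y α, hsum _ ((totalDegree_monomial_le' _ _).trans α.2),
      integral_finsetSum_measure]
    · refine Finset.sum_congr rfl fun x hx => ?_
      rw [integral_smul_measure, integral_dirac, ENNReal.toReal_ofReal (hw x hx).le, smul_eq_mul]
    · intro x _
      exact (integrable_dirac (by simp)).smul_measure ENNReal.ofReal_ne_top

/-- Every measure representing interpolated atoms is supported on these atoms exactly. -/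
lemma support_eq_of_atoms (hK : IsCompact K) {y : MonIdx n (2 * k) → ℝ}
    {S : Finset (Fin n → ℝ)} {w : (Fin n → ℝ) → ℝ} (hw : ∀ x ∈ S, 0 < w x)
    (hsum : ∀ p : MvPolynomial (Fin n) ℝ, p.totalDegree ≤ 2 * k →
      riesz y p = ∑ x ∈ S, w x * eval x p)
    (hq : ∀ x ∈ S, ∃ q : MvPolynomial (Fin n) ℝ, q.totalDegree < k ∧ eval x q = 1 ∧
      ∀ z ∈ S, z ≠ x → eval z q = 0)
    (hμ : Represents K y μ) : μ.support = S := by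
  classical
  -- The integral of `p²` depends only on `y`, so it can be computed from the atoms.
  have hvanish : ∀ p : MvPolynomial (Fin n) ℝ, p.totalDegree ≤ k → (∀ x ∈ S, eval x p = 0) →
      ∀ x ∈ μ.support, eval x p = 0 := by
    intro p hp h x hx
    have h0 : ∫ x, eval x (p ^ 2) ∂μ = 0 := by
      rw [← hμ.riesz_eq_integral hK (totalDegree_sq_le hp), hsum _ (totalDegree_sq_le hp)]
      refine Finset.sum_eq_zero fun x hx => ?_
      rw [map_pow, h x hx]
      ring
    have := eval_eq_zero_of_integral_eq_zero hK hμ.1 (p := p ^ 2) (fun x _ => by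
      rw [map_pow]; exact sq_nonneg _) h0 hx
    rw [map_pow] at this
    exact pow_eq_zero_iff two_ne_zero |>.1 this
  choose! q hqd hq1 hq0 using hq
  have hsub : μ.support ⊆ S := by
    intro x hx
    by_contra hxS
    -- Choose a coordinate in which `x` and `t` differ. Then `(X i - t i) q t` vanishes on all of
    -- `S`; the strict bound on `deg (q t)` pays for the linear factor.
    have hqx : ∀ t ∈ S, eval x (q t) = 0 := by
      intro t ht
      obtain ⟨i, hi⟩ := Function.ne_iff.1 (show x ≠ t from fun h => hxS (h ▸ ht))
      have h := hvanish ((X i - C (t i)) * q t) ?_ ?_ x hx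
      · rw [map_mul, map_sub, eval_X, eval_C, mul_eq_zero, sub_eq_zero] at h
        exact h.resolve_left hi
      · have h1 := totalDegree_mul (X i - C (t i)) (q t)
        have h2 := totalDegree_sub (X i : MvPolynomial (Fin n) ℝ) (C (t i))
        rw [totalDegree_X, totalDegree_C] at h2
        have := hqd t ht
        simp only [max_eq_left zero_le_one] at h2
        omega
      · intro z hz
        rw [map_mul, map_sub, eval_X, eval_C]
        by_cases hzt : z = t
        · rw [hzt, sub_self, zero_mul]
        · rw [hq0 t ht z hz hzt, mul_zero]
    -- This polynomial vanishes on `S`, but equals `1` at a support point outside `S`.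
    have h := hvanish (1 - ∑ t ∈ S, q t) ?_ ?_ x hx
    · rw [map_sub, map_one, map_sum, Finset.sum_eq_zero hqx] at h
      norm_num at h
    · refine (totalDegree_sub _ _).trans (max_le (by simp) ?_)
      exact totalDegree_finsetSum_le fun t ht => (hqd t ht).le
    · intro z hz
      rw [map_sub, map_one, map_sum, Finset.sum_eq_single_of_mem z hz, hq1 z hz, sub_self]
      exact fun t ht htz => hq0 t ht z hz htz.symm
  -- If an atom `t` were missing, `(q t)²` would vanish almost everywhere, whereas its integral is
  -- `w t > 0`.
  refine hsub.antisymm fun t ht => ?_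
  by_contra htμ
  have hae : ∀ᵐ x ∂μ, eval x (q t ^ 2) = 0 := by
    filter_upwards [Measure.support_mem_ae (μ := μ)] with x hx
    rw [map_pow, hq0 t ht x (hsub hx) fun h => htμ (h ▸ hx)]
    ring
  have h := hsum _ (totalDegree_sq_le (hqd t ht).le)
  rw [hμ.riesz_eq_integral hK (totalDegree_sq_le (hqd t ht).le), integral_congr_ae hae,
    integral_zero, Finset.sum_eq_single_of_mem t ht, map_pow, hq1 t ht] at h
  · have := hw t ht
    linarith
  · intro z hz hzt
    rw [map_pow, hq0 t ht z hz hzt]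
    ring

end Integration

end MomentSOS

namespace MomentSOS

variable {n nX m r s k : ℕ} {g : Fin nX → MvPolynomial (Fin n) ℝ}

/-! ### The truncated quadratic module is a convex cone -/

lemma add_mem_sosCone {p q : MvPolynomial (Fin n) ℝ} (hp : p ∈ sosCone n r)
    (hq : q ∈ sosCone n r) : p + q ∈ sosCone n r := by
  obtain ⟨N, f, hf, rfl⟩ := hp
  obtain ⟨M, h, hh, rfl⟩ := hq
  refine ⟨N + M, Fin.append f h, fun i => ?_, ?_⟩
  · refine Fin.addCases (fun i => ?_) (fun i => ?_) i
    · simpa using hf i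
    · simpa using hh i
  · simp [Fin.sum_univ_add]

lemma smul_mem_sosCone {p : MvPolynomial (Fin n) ℝ} (hp : p ∈ sosCone n r) {c : ℝ} (hc : 0 ≤ c) :
    c • p ∈ sosCone n r := by
  obtain ⟨N, f, hf, rfl⟩ := hp
  refine ⟨N, fun i => Real.sqrt c • f i, fun i => (totalDegree_smul_le _ _).trans (hf i), ?_⟩
  simp only [smul_pow, Real.sq_sqrt hc, Finset.smul_sum]

lemma sq_mem_sosCone {q : MvPolynomial (Fin n) ℝ} (hq : q.totalDegree ≤ r) :
    q ^ 2 ∈ sosCone n r := ⟨1, fun _ => q, fun _ => hq, by simp⟩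

lemma zero_mem_sosCone : (0 : MvPolynomial (Fin n) ℝ) ∈ sosCone n r := ⟨0, 0, nofun, by simp⟩

lemma add_mem_quadModule {p q : MvPolynomial (Fin n) ℝ} (hp : p ∈ quadModule g k)
    (hq : q ∈ quadModule g k) : p + q ∈ quadModule g k := by
  obtain ⟨p₀, hp₀, p', hp', rfl⟩ := hp
  obtain ⟨q₀, hq₀, q', hq', rfl⟩ := hq
  refine ⟨_, add_mem_sosCone hp₀ hq₀, p' + q', fun j => add_mem_sosCone (hp' j) (hq' j), ?_⟩
  simp only [Pi.add_apply, mul_add, Finset.sum_add_distrib]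
  ring

lemma smul_mem_quadModule {p : MvPolynomial (Fin n) ℝ} (hp : p ∈ quadModule g k) {c : ℝ}
    (hc : 0 ≤ c) : c • p ∈ quadModule g k := by
  obtain ⟨p₀, hp₀, p', hp', rfl⟩ := hp
  refine ⟨_, smul_mem_sosCone hp₀ hc, c • p', fun j => smul_mem_sosCone (hp' j) hc, ?_⟩
  simp only [smul_add, Finset.smul_sum, Pi.smul_apply, mul_smul_comm]

lemma mem_quadModule_of_mem_sosCone {p : MvPolynomial (Fin n) ℝ} (hp : p ∈ sosCone n k) :
    p ∈ quadModule g k :=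
  ⟨p, hp, 0, fun _ => zero_mem_sosCone, by simp⟩

lemma sq_mem_quadModule {q : MvPolynomial (Fin n) ℝ} (hq : q.totalDegree ≤ k) :
    q ^ 2 ∈ quadModule g k := mem_quadModule_of_mem_sosCone (sq_mem_sosCone hq)

lemma zero_mem_quadModule : (0 : MvPolynomial (Fin n) ℝ) ∈ quadModule g k :=
  mem_quadModule_of_mem_sosCone zero_mem_sosCone

lemma C_mem_quadModule {c : ℝ} (hc : 0 ≤ c) : C c ∈ quadModule g k := by
  have := smul_mem_quadModule (g := g) (k := k) (sq_mem_quadModule (q := 1) (by simp)) hc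
  rwa [one_pow, smul_eq_C_mul, mul_one] at this

lemma mul_sq_mem_quadModule (j : Fin nX) {q : MvPolynomial (Fin n) ℝ}
    (hq : q.totalDegree ≤ k - halfDeg (g j)) : g j * q ^ 2 ∈ quadModule g k := by
  classical
  refine ⟨0, zero_mem_sosCone, Pi.single j (q ^ 2), fun i => ?_, ?_⟩
  · by_cases h : i = j
    · subst h
      simpa using sq_mem_sosCone hq
    · simpa [h] using zero_mem_sosCone
  · rw [zero_add, Finset.sum_eq_single j]
    · simp
    · intro i _ h
      simp [h]
    · simp

lemma sum_mem_quadModule {ι : Type*} (t : Finset ι) {p : ι → MvPolynomial (Fin n) ℝ}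
    (hp : ∀ i ∈ t, p i ∈ quadModule g k) : ∑ i ∈ t, p i ∈ quadModule g k := by
  classical
  induction t using Finset.induction_on with
  | empty => simpa using zero_mem_quadModule
  | insert i t hi ih =>
    rw [Finset.sum_insert hi]
    exact add_mem_quadModule (hp i (Finset.mem_insert_self i t))
      (ih fun j hj => hp j (Finset.mem_insert_of_mem hj))

/-! ### An explicit ball constraint makes `1` an interior point of the truncated quadratic module -/

lemma halfDeg_ballPoly_le (R : ℝ) : halfDeg (ballPoly n R) ≤ 1 := by
  have h : (ballPoly n R).totalDegree ≤ 2 := by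
    refine (totalDegree_sub _ _).trans (max_le (by rw [totalDegree_C]; omega)
      (totalDegree_finsetSum_le fun i _ => ?_))
    exact (totalDegree_pow _ _).trans (by simp)
  unfold halfDeg
  omega

/-- Induction on the degree, by `R²N - x_i²m² = R²(N - m²) + (R² - ∑ x_l²)m² + ∑_{l≠i} x_l²m²`. The
ball polynomial has half degree at most `1`, so multiplying it by `m²` with `deg m < k` stays within
the truncation. -/
lemma exists_C_sub_sq_monomial_mem {j : Fin nX} {R : ℝ} (hj : g j = ballPoly n R) (d : ℕ)
    (hd : d ≤ k) (α : Fin n →₀ ℕ) (hα : α.degree = d) :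
    ∃ N : ℝ, C N - (monomial α (1 : ℝ)) ^ 2 ∈ quadModule g k := by
  classical
  induction d generalizing α with
  | zero =>
    rw [Finsupp.degree_eq_zero_iff] at hα
    subst hα
    refine ⟨1, ?_⟩
    rw [show (monomial (0 : Fin n →₀ ℕ) (1 : ℝ)) = 1 from rfl, C_1, one_pow, sub_self]
    exact zero_mem_quadModule
  | succ d ih =>
    obtain ⟨i, hi⟩ : ∃ i, α i ≠ 0 := by
      by_contra! h
      have : α = 0 := Finsupp.ext h
      simp [this] at hα
    have hα' : α = Finsupp.single i 1 + (α - Finsupp.single i 1) := by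
      rw [add_tsub_cancel_of_le]
      simpa [Nat.one_le_iff_ne_zero] using hi
    set β := α - Finsupp.single i 1
    have hβ : β.degree = d := by
      have := congrArg Finsupp.degree hα'
      rw [map_add, Finsupp.degree_single, hα] at this
      omega
    have hm : monomial α (1 : ℝ) = X i * monomial β 1 := by
      rw [X, monomial_mul, mul_one, ← hα']
    have hβd := (totalDegree_monomial_le' β 1).trans_eq hβ
    obtain ⟨N, hN⟩ := ih (by omega) β hβ
    refine ⟨R ^ 2 * N, ?_⟩
    have h1 := smul_mem_quadModule hN (sq_nonneg R)
    have h2 : g j * (monomial β (1 : ℝ)) ^ 2 ∈ quadModule g k :=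
      mul_sq_mem_quadModule j (by have := halfDeg_ballPoly_le (n := n) R; rw [hj]; omega)
    have h3 : ∑ l ∈ Finset.univ.erase i, (X l * monomial β (1 : ℝ)) ^ 2 ∈ quadModule g k :=
      sum_mem_quadModule _ fun l _ => sq_mem_quadModule (totalDegree_X_mul_le (by omega))
    have h := add_mem_quadModule (add_mem_quadModule h1 h2) h3
    have hsum := Finset.add_sum_erase Finset.univ
      (fun l => (X l * monomial β (1 : ℝ) : MvPolynomial (Fin n) ℝ) ^ 2) (Finset.mem_univ i)
    rw [← sub_eq_iff_eq_add'.2 hsum.symm, hj] at h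
    convert! h using 1
    rw [hm, smul_eq_C_mul, ballPoly, C_mul, sub_mul, Finset.sum_mul]
    simp only [mul_pow]
    ring

lemma exists_C_add_monomial_mem {j : Fin nX} {R : ℝ} (hj : g j = ballPoly n R)
    (γ : MonIdx n (2 * k)) :
    ∃ N : ℝ, ∀ c : ℝ, |c| ≤ 1 → C N + monomial γ.1 c ∈ quadModule g k := by
  obtain ⟨α, β, hα, hβ, hγ⟩ := exists_add_eq_of_degree_le γ.2
  obtain ⟨N, hN⟩ := exists_C_sub_sq_monomial_mem hj _ hα α rfl
  obtain ⟨M, hM⟩ := exists_C_sub_sq_monomial_mem hj _ hβ β rfl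
  have hαd := (totalDegree_monomial_le' α 1).trans hα
  have hβd := (totalDegree_monomial_le' β 1).trans hβ
  refine ⟨N + M, fun c hc => ?_⟩
  -- With `γ = α + β`, the identity is `N + M + c x^α x^β = (N - x^{2α}) + (M - x^{2β}) + (x^α +
  -- (c/2)x^β)² + (1 - c²/4)x^{2β}`.
  have h1 : (monomial α (1 : ℝ) + (c / 2) • monomial β (1 : ℝ)) ^ 2 ∈ quadModule g k :=
    sq_mem_quadModule ((totalDegree_add _ _).trans
      (max_le hαd ((totalDegree_smul_le _ _).trans hβd)))
  have h2 : (1 - (c / 2) ^ 2) • (monomial β (1 : ℝ)) ^ 2 ∈ quadModule g k :=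
    smul_mem_quadModule (sq_mem_quadModule hβd) (by
      have := (sq_le_one_iff_abs_le_one c).2 hc
      linarith)
  have h := add_mem_quadModule (add_mem_quadModule hN hM) (add_mem_quadModule h1 h2)
  convert! h using 1
  have hm : monomial γ.1 c = C (c / 2) * 2 * (monomial α 1 * monomial β 1) := by
    have : (2 : MvPolynomial (Fin n) ℝ) = C 2 := (map_ofNat C 2).symm
    rw [monomial_mul, ← hγ, this, ← C_mul, C_mul_monomial]
    ring_nf
  rw [hm]
  simp only [smul_eq_C_mul, C_add, C_sub, C_pow, C_1]
  ring

/-- A whole sup-norm ball of coefficients around the constant `N` lies in the module, so after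
scaling `1` is an interior point. -/
lemma exists_C_add_toPoly_mem {j : Fin nX} {R : ℝ} (hj : g j = ballPoly n R) (k : ℕ) :
    ∃ N : ℝ, 0 < N ∧ ∀ w : MonIdx n (2 * k) → ℝ, (∀ α, |w α| ≤ 1) →
      C N + toPoly w ∈ quadModule g k := by
  choose N hN using exists_C_add_monomial_mem (k := k) hj
  -- The absolute value and the `1` only secure positivity, since the individual bounds `N γ` carry
  -- no sign.
  refine ⟨|∑ γ, N γ| + 1, by positivity, fun w hw => ?_⟩
  have h := add_mem_quadModule
    (C_mem_quadModule (g := g) (k := k) (c := |∑ γ, N γ| + 1 - ∑ γ, N γ)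
      (by linarith [le_abs_self (∑ γ, N γ)]))
    (sum_mem_quadModule Finset.univ fun γ _ => hN γ (w γ) (hw γ))
  convert! h using 1
  rw [Finset.sum_add_distrib, toPoly_apply, C_sub, map_sum]
  ring

end MomentSOS

namespace MomentSOS

variable {n nX m r s k : ℕ} {g : Fin nX → MvPolynomial (Fin n) ℝ}
  {a : Fin m → MvPolynomial (Fin n) ℝ} {b : Fin m → ℝ}

/-! ### Strong duality between the moment and the SOS problems -/

lemma lincomb_add (a : Fin m → MvPolynomial (Fin n) ℝ) (u v : Fin m → ℝ) :
    lincomb a (u + v) = lincomb a u + lincomb a v := by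
  simp [lincomb, add_mul, Finset.sum_add_distrib]

lemma lincomb_smul (a : Fin m → MvPolynomial (Fin n) ℝ) (c : ℝ) (u : Fin m → ℝ) :
    lincomb a (c • u) = c • lincomb a u := by
  simp [lincomb, smul_eq_C_mul, Finset.mul_sum, mul_assoc]

/-- The space in which the moment and SOS problems are separated: two coefficient vectors and a
value. -/
abbrev DualitySpace (n k : ℕ) : Type :=
  (MonIdx n (2 * k) → ℝ) × (MonIdx n (2 * k) → ℝ) × ℝ

/-- The linear constraints of the SOS problem. -/
noncomputable def constraintMap (a : Fin m → MvPolynomial (Fin n) ℝ) (b : Fin m → ℝ) (k : ℕ) :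
    (Fin m → ℝ) →ₗ[ℝ] DualitySpace n k where
  toFun v := (coeffVec n (2 * k) (lincomb a v), -coeffVec n (2 * k) (lincomb a v), b ⬝ᵥ v)
  map_add' u v := by
    simp [lincomb_add, dotProduct_add, add_comm]
  map_smul' c v := by
    simp [lincomb_smul, dotProduct_smul]

/-- The conic constraints of the SOS problem. -/
def conicPart (g : Fin nX → MvPolynomial (Fin n) ℝ) (k : ℕ) : Set (DualitySpace n k) :=
  {e | ∃ p ∈ quadModule g k, ∃ q ∈ quadModule g k, ∃ t : ℝ, 0 ≤ t ∧
    e = (coeffVec n (2 * k) p, coeffVec n (2 * k) q, -t)}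

lemma add_mem_conicPart {e f : DualitySpace n k} (he : e ∈ conicPart g k)
    (hf : f ∈ conicPart g k) : e + f ∈ conicPart g k := by
  obtain ⟨p, hp, q, hq, t, ht, rfl⟩ := he
  obtain ⟨p', hp', q', hq', t', ht', rfl⟩ := hf
  refine ⟨p + p', add_mem_quadModule hp hp', q + q', add_mem_quadModule hq hq', t + t',
    add_nonneg ht ht', ?_⟩
  simp [add_comm]

lemma smul_mem_conicPart {e : DualitySpace n k} (he : e ∈ conicPart g k) {c : ℝ} (hc : 0 ≤ c) :
    c • e ∈ conicPart g k := by
  obtain ⟨p, hp, q, hq, t, ht, rfl⟩ := he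
  refine ⟨c • p, smul_mem_quadModule hp hc, c • q, smul_mem_quadModule hq hc, c * t,
    mul_nonneg hc ht, ?_⟩
  simp

lemma zero_mem_conicPart : (0 : DualitySpace n k) ∈ conicPart g k :=
  ⟨0, zero_mem_quadModule, 0, zero_mem_quadModule, 0, le_rfl, by simp; rfl⟩

lemma convex_conicPart : Convex ℝ (conicPart g k) := fun _ hx _ hy _ _ hc hd _ =>
  add_mem_conicPart (smul_mem_conicPart hx hc) (smul_mem_conicPart hy hd)

/-- The point expressing that the SOS problem attains the value `c`. -/
noncomputable def valuePoint (n k : ℕ) (c : ℝ) : DualitySpace n k :=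
  (coeffVec n (2 * k) 1, coeffVec n (2 * k) 1, c)

/-- The components read `1 = p + aᵀv`, `1 = q - aᵀv` and `c = bᵀv - t`, with `t ≥ 0` a slack.
Degrees at most `2k` let coefficient equalities become polynomial equalities. -/
lemma exists_sosFeasible_of_valuePoint_eq (hk : minOrder g ≤ k)
    (ha : ∀ i, (a i).totalDegree ≤ k) {c : ℝ} {e : DualitySpace n k} (he : e ∈ conicPart g k)
    (v : Fin m → ℝ) (h : valuePoint n k c = e + constraintMap a b k v) :
    SOSFeasible g a k v ∧ c ≤ b ⬝ᵥ v := by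
  obtain ⟨p, hp, q, hq, t, ht, rfl⟩ := he
  simp only [valuePoint, constraintMap, LinearMap.coe_mk, AddHom.coe_mk, Prod.mk_add_mk,
    Prod.mk.injEq] at h
  obtain ⟨h1, h2, h3⟩ := h
  have hl : (lincomb a v).totalDegree ≤ 2 * k :=
    (totalDegree_lincomb_le ha v).trans (by omega)
  rw [← map_add] at h1
  rw [← sub_eq_add_neg, ← map_sub] at h2
  have h1' := eq_of_coeffVec_eq (by simp)
    ((totalDegree_add _ _).trans (max_le (totalDegree_le_of_mem_quadModule hk hp) hl)) h1
  have h2' := eq_of_coeffVec_eq (by simp)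
    ((totalDegree_sub _ _).trans (max_le (totalDegree_le_of_mem_quadModule hk hq) hl)) h2
  refine ⟨⟨?_, ?_⟩, by linarith⟩
  · convert! hq using 1
    rw [h2']
    ring
  · convert! hp using 1
    rw [h1']
    ring

/-- The functional on the duality space given by two moment sequences and a multiplier. -/
noncomputable def pairing (yp ym : MonIdx n (2 * k) → ℝ) (τ : ℝ) : DualitySpace n k →ₗ[ℝ] ℝ where
  toFun e := e.1 ⬝ᵥ yp + e.2.1 ⬝ᵥ ym - τ * e.2.2
  map_add' e f := by
    simp only [Prod.fst_add, Prod.snd_add, add_dotProduct]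
    ring
  map_smul' c e := by
    simp only [Prod.smul_fst, Prod.smul_snd, smul_dotProduct, smul_eq_mul, RingHom.id_apply]
    ring

lemma pairing_coeffVec (yp ym : MonIdx n (2 * k) → ℝ) (τ : ℝ) (p q : MvPolynomial (Fin n) ℝ)
    (t : ℝ) : pairing yp ym τ (coeffVec n (2 * k) p, coeffVec n (2 * k) q, t) =
      riesz yp p + riesz ym q - τ * t := rfl

lemma pairing_fst (yp ym : MonIdx n (2 * k) → ℝ) (τ : ℝ) (p : MvPolynomial (Fin n) ℝ) :
    pairing yp ym τ (coeffVec n (2 * k) p, 0, 0) = riesz yp p := by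
  have := pairing_coeffVec yp ym τ p 0 0
  rw [map_zero] at this
  rw [this, ← rieszLin_apply ym, map_zero]
  ring

lemma pairing_snd (yp ym : MonIdx n (2 * k) → ℝ) (τ : ℝ) (p : MvPolynomial (Fin n) ℝ) :
    pairing yp ym τ (0, coeffVec n (2 * k) p, 0) = riesz ym p := by
  have := pairing_coeffVec yp ym τ 0 p 0
  rw [map_zero] at this
  rw [this, ← rieszLin_apply yp, map_zero]
  ring

lemma pairing_thd (yp ym : MonIdx n (2 * k) → ℝ) (τ : ℝ) (t : ℝ) :
    pairing yp ym τ (0, 0, t) = -(τ * t) := by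
  simp [pairing]

lemma pairing_constraintMap (yp ym : MonIdx n (2 * k) → ℝ) (τ : ℝ) (v : Fin m → ℝ) :
    pairing yp ym τ (constraintMap a b k v) =
      ∑ i, v i * (riesz yp (a i) - riesz ym (a i) - τ * b i) := by
  change pairing yp ym τ (_, -coeffVec n (2 * k) (lincomb a v), _) = _
  rw [← map_neg, pairing_coeffVec, ← rieszLin_apply ym, map_neg, rieszLin_apply, riesz_lincomb,
    riesz_lincomb, dotProduct, Finset.mul_sum, ← sub_eq_add_neg, ← Finset.sum_sub_distrib,
    ← Finset.sum_sub_distrib]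
  exact Finset.sum_congr rfl fun i _ => by ring

lemma exists_eq_pairing (φ : DualitySpace n k →ₗ[ℝ] ℝ) :
    ∃ yp ym τ, φ = pairing yp ym τ := by
  classical
  refine ⟨fun α => φ (Pi.single α 1, 0, 0), fun α => φ (0, Pi.single α 1, 0), -φ (0, 0, 1),
    LinearMap.ext fun e => ?_⟩
  obtain ⟨v, w, t⟩ := e
  have key : ∀ (f : (MonIdx n (2 * k) → ℝ) →ₗ[ℝ] ℝ) (v : MonIdx n (2 * k) → ℝ),
      f v = ∑ α, v α * f (Pi.single α 1) := by
    intro f v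
    rw [LinearMap.pi_apply_eq_sum_univ f v]
    refine Finset.sum_congr rfl fun α _ => ?_
    rw [smul_eq_mul]
    congr 2
    ext β
    simp [Pi.single_apply, eq_comm]
  have hv : φ (v, 0, 0) = ∑ α, v α * φ (Pi.single α 1, 0, 0) := key (φ ∘ₗ LinearMap.inl ℝ _ _) v
  have hw : φ (0, w, 0) = ∑ α, w α * φ (0, Pi.single α 1, 0) :=
    key (φ ∘ₗ LinearMap.inr ℝ _ _ ∘ₗ LinearMap.inl ℝ _ _) w
  have ht : φ (0, 0, t) = t * φ (0, 0, 1) := by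
    simpa using φ.map_smul t (0, 0, 1)
  have : ((v, w, t) : DualitySpace n k) = (v, 0, 0) + (0, w, 0) + (0, 0, t) := by simp
  rw [this, map_add, map_add, map_add, map_add, hv, hw, ht]
  simp [pairing, dotProduct, mul_comm]

lemma riesz_constraint_of_pairing {yp ym : MonIdx n (2 * k) → ℝ} {τ : ℝ}
    (h : ∀ v, pairing yp ym τ (constraintMap a b k v) = 0) (i : Fin m) :
    riesz yp (a i) - riesz ym (a i) = τ * b i := by
  classical
  have := h (Pi.single i 1)
  rw [pairing_constraintMap, Finset.sum_eq_single i (fun j _ hj => by simp [hj]) (by simp)] at this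
  simpa [sub_eq_zero] using this

lemma smul_mem_momCone {y : MonIdx n (2 * k) → ℝ} (hy : y ∈ momCone g k) {c : ℝ} (hc : 0 ≤ c) :
    c • y ∈ momCone g k := by
  rw [mem_momCone_iff] at hy ⊢
  simp only [riesz_smul_left]
  exact ⟨fun q hq => mul_nonneg hc (hy.1 q hq), fun j q hq => mul_nonneg hc (hy.2 j q hq)⟩

/-- Homogenized optimality: dividing by `τ > 0` restores the constraint right-hand side `b`. -/
lemma MomOptimal.mul_le {yp ym zp zm : MonIdx n (2 * k) → ℝ} (hy : MomOptimal g a b k yp ym)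
    {τ : ℝ} (hτ : 0 < τ) (hzp : zp ∈ momCone g k) (hzm : zm ∈ momCone g k)
    (hz : ∀ i, riesz zp (a i) - riesz zm (a i) = τ * b i) :
    τ * (riesz yp 1 + riesz ym 1) ≤ riesz zp 1 + riesz zm 1 := by
  have hτ' := (inv_pos.2 hτ).le
  have h := hy.2 (τ⁻¹ • zp) (τ⁻¹ • zm)
    ⟨smul_mem_momCone hzp hτ', smul_mem_momCone hzm hτ', fun i => by
      rw [riesz_smul_left, riesz_smul_left, ← mul_sub, hz, inv_mul_cancel_left₀ hτ.ne']⟩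
  rw [riesz_smul_left, riesz_smul_left, ← mul_add] at h
  have := mul_le_mul_of_nonneg_left h hτ.le
  rwa [mul_inv_cancel_left₀ hτ.ne'] at this

open scoped Pointwise

lemma convex_conicPart_add_range :
    Convex ℝ (conicPart g k + (LinearMap.range (constraintMap a b k) : Set (DualitySpace n k))) :=
  convex_conicPart.add (Submodule.convex _)

/-- An element of the moment cone with vanishing total mass is zero if there is an explicit ball
constraint. -/
lemma eq_zero_of_riesz_one_le {j : Fin nX} {R : ℝ} (hj : g j = ballPoly n R)
    {y : MonIdx n (2 * k) → ℝ} (hy : y ∈ momCone g k) (h : riesz y 1 ≤ 0) : y = 0 := by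
  classical
  obtain ⟨N, hN, hQ⟩ := exists_C_add_toPoly_mem hj k
  have hC : riesz y (C N) = N * riesz y 1 := by
    have := (rieszLin y).map_smul N 1
    rwa [smul_eq_C_mul, mul_one, smul_eq_mul, rieszLin_apply, rieszLin_apply] at this
  have hle : ∀ w : MonIdx n (2 * k) → ℝ, (∀ α, |w α| ≤ 1) → 0 ≤ w ⬝ᵥ y := by
    intro w hw
    have := riesz_nonneg_of_mem_quadModule hy (hQ w hw)
    rw [riesz_add, hC, riesz_eq_dotProduct y (toPoly w), coeffVec_toPoly] at this
    nlinarith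
  ext α
  -- Both signs of a unit coordinate vector are admissible tests, which forces each moment to be
  -- zero.
  have hs : ∀ c : ℝ, |c| ≤ 1 → ∀ β : MonIdx n (2 * k), |Pi.single (M := fun _ => ℝ) α c β| ≤ 1 := by
    intro c hc β
    by_cases hβ : β = α
    · subst hβ
      simpa using hc
    · simp [hβ]
  have h1 := hle (Pi.single α 1) (hs 1 (by simp))
  have h2 := hle (Pi.single α (-1)) (hs (-1) (by simp))
  simp only [single_dotProduct] at h1 h2
  simp only [Pi.zero_apply]
  linarith

/-- Near `(1, 1, -1)` both polynomials stay in the module and the slack stays positive; this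
supplies the interior needed to separate a convex set that need not be closed. -/
lemma mem_nhds_conicPart {j : Fin nX} {R : ℝ} (hj : g j = ballPoly n R) :
    conicPart g k ∈ nhds (valuePoint n k (-1)) := by
  obtain ⟨N, hN, hQ⟩ := exists_C_add_toPoly_mem hj k
  have hmem : ∀ w ∈ Metric.closedBall (coeffVec n (2 * k) 1) N⁻¹,
      ∃ p ∈ quadModule g k, coeffVec n (2 * k) p = w := by
    intro w hw
    rw [mem_closedBall_iff_norm] at hw
    have hbd : ∀ α, |(N • (w - coeffVec n (2 * k) 1)) α| ≤ 1 := by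
      intro α
      have := (norm_le_pi_norm (w - coeffVec n (2 * k) 1) α).trans hw
      rw [Real.norm_eq_abs] at this
      rw [Pi.smul_apply, smul_eq_mul, abs_mul, abs_of_pos hN]
      calc N * _ ≤ N * N⁻¹ := mul_le_mul_of_nonneg_left this hN.le
        _ = 1 := mul_inv_cancel₀ hN.ne'
    refine ⟨_, smul_mem_quadModule (hQ _ hbd) (inv_pos.2 hN).le, ?_⟩
    have hC : (C N : MvPolynomial (Fin n) ℝ) = N • 1 := by rw [smul_eq_C_mul, mul_one]
    rw [map_smul, map_add, coeffVec_toPoly, hC, map_smul, ← smul_add, add_sub_cancel,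
      inv_smul_smul₀ hN.ne']
  have hball := Metric.closedBall_mem_nhds (coeffVec n (2 * k) (1 : MvPolynomial (Fin n) ℝ))
    (inv_pos.2 hN)
  filter_upwards [prod_mem_nhds hball
    (prod_mem_nhds hball (Iic_mem_nhds (show (-1 : ℝ) < 0 by norm_num)))]
  rintro ⟨w, z, t⟩ ⟨hw, hz, ht⟩
  obtain ⟨p, hp, rfl⟩ := hmem w hw
  obtain ⟨q, hq, rfl⟩ := hmem z hz
  exact ⟨p, hp, q, hq, -t, by simpa using ht, by simp⟩

/-- Absence of a duality gap under an explicit ball constraint. -/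
theorem exists_sosFeasible_of_ballPoly {j : Fin nX} {R : ℝ} (hj : g j = ballPoly n R)
    (hk : minOrder g ≤ k) (ha : ∀ i, (a i).totalDegree ≤ k)
    {yp ym : MonIdx n (2 * k) → ℝ} (hy : MomOptimal g a b k yp ym) {c : ℝ}
    (hc : c < riesz yp 1 + riesz ym 1) : ∃ v, SOSFeasible g a k v ∧ c ≤ b ⬝ᵥ v := by
  by_contra hno
  set D := conicPart g k + (LinearMap.range (constraintMap a b k) : Set (DualitySpace n k)) with hD
  have hsub : conicPart g k ⊆ D := fun e he => ⟨e, he, 0, Submodule.zero_mem _, add_zero e⟩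
  have hint : valuePoint n k (-1) ∈ interior D :=
    mem_interior_iff_mem_nhds.2 (Filter.mem_of_superset (mem_nhds_conicPart hj) hsub)
  have hnot : valuePoint n k c ∉ interior D := by
    intro h
    obtain ⟨e, he, _, ⟨v, rfl⟩, h⟩ := interior_subset h
    exact hno ⟨v, exists_sosFeasible_of_valuePoint_eq hk ha he v h.symm⟩
  obtain ⟨f, hf0, hf⟩ := geometric_hahn_banach_of_nonempty_interior_point
    convex_conicPart_add_range hnot ⟨_, hint⟩
  -- `f` is bounded above on a cone, so it cannot be positive anywhere on it.
  have hcone : ∀ e ∈ conicPart g k, ∀ v, f (e + constraintMap a b k v) ≤ 0 := by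
    intro e he v
    by_contra! h
    obtain ⟨N, hN⟩ := exists_nat_gt (f (valuePoint n k c) / f (e + constraintMap a b k v))
    rw [div_lt_iff₀ h] at hN
    have := hf _ ⟨_, smul_mem_conicPart he (Nat.cast_nonneg N), _, ⟨(N : ℝ) • v, rfl⟩, rfl⟩
    simp only [map_smul, ← smul_add] at this
    rw [smul_eq_mul] at this
    linarith
  obtain ⟨zp, zm, τ, hpair⟩ := exists_eq_pairing (-f.toLinearMap)
  have hpair' : ∀ e, pairing zp zm τ e = -f e := fun e => by rw [← hpair]; rfl
  have hnonneg : ∀ e ∈ conicPart g k, 0 ≤ pairing zp zm τ e := fun e he => by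
    have := hcone e he 0
    rw [map_zero, add_zero] at this
    rw [hpair']
    linarith
  have hL : ∀ v, pairing zp zm τ (constraintMap a b k v) = 0 := fun v => by
    have h1 := hcone 0 zero_mem_conicPart v
    have h2 := hcone 0 zero_mem_conicPart (-v)
    rw [zero_add] at h1 h2
    rw [map_neg, map_neg] at h2
    rw [hpair']
    linarith
  have hp : ∀ p ∈ quadModule g k, 0 ≤ riesz zp p := fun p hp => by
    rw [← pairing_fst zp zm τ]
    exact hnonneg _ ⟨p, hp, 0, zero_mem_quadModule, 0, le_rfl, by simp⟩
  have hm : ∀ p ∈ quadModule g k, 0 ≤ riesz zm p := fun p hp => by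
    rw [← pairing_snd zp zm τ]
    exact hnonneg _ ⟨0, zero_mem_quadModule, p, hp, 0, le_rfl, by simp⟩
  have hτ : 0 ≤ τ := by
    have := hnonneg (0, 0, -1)
      ⟨0, zero_mem_quadModule, 0, zero_mem_quadModule, 1, zero_le_one, by simp⟩
    rw [pairing_thd] at this
    linarith
  have hzp : zp ∈ momCone g k := mem_momCone_iff.2
    ⟨fun q hq => hp _ (sq_mem_quadModule hq), fun j q hq => hp _ (mul_sq_mem_quadModule j hq)⟩
  have hzm : zm ∈ momCone g k := mem_momCone_iff.2
    ⟨fun q hq => hm _ (sq_mem_quadModule hq), fun j q hq => hm _ (mul_sq_mem_quadModule j hq)⟩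
  have hval : riesz zp 1 + riesz zm 1 ≤ τ * c := by
    have h0 := hf 0 ⟨0, zero_mem_conicPart, 0, Submodule.zero_mem _, add_zero 0⟩
    have := pairing_coeffVec zp zm τ 1 1 c
    rw [hpair'] at this
    change -f (valuePoint n k c) = _ at this
    rw [map_zero] at h0
    linarith
  -- If `τ > 0`, rescaling gives a moment value at most `c`, below the optimum. If `τ = 0`, both
  -- masses vanish, hence both sequences and `f` itself, although `f ≠ 0`.
  obtain hτ | hτ := hτ.lt_or_eq
  · have := hy.mul_le hτ hzp hzm (riesz_constraint_of_pairing hL)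
    nlinarith
  · have h1 : (1 : MvPolynomial (Fin n) ℝ) ∈ quadModule g k := by
      simpa using C_mem_quadModule (g := g) (k := k) zero_le_one
    have hp1 := hp 1 h1
    have hm1 := hm 1 h1
    rw [← hτ, zero_mul] at hval
    refine hf0 (ContinuousLinearMap.ext fun e => ?_)
    have := hpair' e
    rw [eq_zero_of_riesz_one_le hj hzp (by linarith), eq_zero_of_riesz_one_le hj hzm (by linarith),
      ← hτ] at this
    simp [pairing] at this
    simpa using this

end MomentSOS

/-! ### Strong duality when the semialgebraic set has nonempty interior. -/

namespace MomentSOS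

variable {n nX m r s k : ℕ} {g : Fin nX → MvPolynomial (Fin n) ℝ}
  {a : Fin m → MvPolynomial (Fin n) ℝ} {b : Fin m → ℝ}

/-- Normalized generators of the truncated quadratic module. -/
def normalizedGenerators (g : Fin nX → MvPolynomial (Fin n) ℝ) (k : ℕ) :
    Set (MvPolynomial (Fin n) ℝ) :=
  (fun w : MonIdx n k → ℝ => toPoly w ^ 2) '' Metric.sphere 0 1 ∪
    ⋃ j ∈ {j | g j ≠ 0},
      (fun w : MonIdx n (k - halfDeg (g j)) → ℝ => g j * toPoly w ^ 2) '' Metric.sphere 0 1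

lemma normalizedGenerators_subset : normalizedGenerators g k ⊆ quadModule g k := by
  rintro p (⟨w, -, rfl⟩ | hp)
  · exact sq_mem_quadModule (totalDegree_toPoly_le w)
  · simp only [Set.mem_iUnion] at hp
    obtain ⟨j, -, w, -, rfl⟩ := hp
    exact mul_sq_mem_quadModule j (totalDegree_toPoly_le w)

lemma continuous_coeffVec_mul_sq (p : MvPolynomial (Fin n) ℝ) :
    Continuous fun w : MonIdx n r → ℝ => coeffVec n s (p * toPoly w ^ 2) := by
  classical
  refine continuous_pi fun γ => ?_
  -- Each coefficient of `p q²` is a quadratic form in the coefficients of `q`, namely the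
  -- localizing form of a coordinate sequence.
  have h : ∀ w : MonIdx n r → ℝ, coeffVec n s (p * toPoly w ^ 2) γ =
      w ⬝ᵥ (locMatrix r p (Pi.single γ (1 : ℝ))).mulVec w := fun w => by
    rw [dotProduct_locMatrix_mulVec, riesz_eq_dotProduct, dotProduct_single, mul_one, sq]
  simp only [h]
  exact continuous_id.dotProduct (continuous_const.matrix_mulVec continuous_id)

lemma isCompact_coeffVec_normalizedGenerators (s : ℕ) :
    IsCompact (coeffVec n s '' normalizedGenerators g k) := by
  rw [normalizedGenerators, Set.image_union, Set.image_iUnion₂]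
  refine IsCompact.union ?_ ((Set.toFinite _).isCompact_biUnion fun j _ => ?_)
  · rw [Set.image_image]
    refine (isCompact_sphere 0 1).image ?_
    simpa using continuous_coeffVec_mul_sq (n := n) (r := k) (s := s) 1
  · rw [Set.image_image]
    exact (isCompact_sphere 0 1).image (continuous_coeffVec_mul_sq (g j))

lemma toPoly_smul_sq_nonneg {ψ : MvPolynomial (Fin n) ℝ →ₗ[ℝ] ℝ} {p : MvPolynomial (Fin n) ℝ}
    (h : ∀ w ∈ Metric.sphere (0 : MonIdx n r → ℝ) 1, 0 ≤ ψ (p * toPoly w ^ 2))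
    {q : MvPolynomial (Fin n) ℝ} (hq : q.totalDegree ≤ r) : 0 ≤ ψ (p * q ^ 2) := by
  rw [← toPoly_coeffVec hq]
  set v := coeffVec n r q
  by_cases hv : v = 0
  · simp [hv]
  · have hv' : 0 < ‖v‖ := norm_pos_iff.2 hv
    have hw := h (‖v‖⁻¹ • v) (by simp [norm_smul, hv'.ne'])
    have hvw : v = ‖v‖ • ‖v‖⁻¹ • v := by rw [smul_inv_smul₀ hv'.ne']
    rw [hvw, map_smul, smul_pow, mul_smul_comm, map_smul]
    exact smul_nonneg (sq_nonneg _) hw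

/-- Homogeneity in `q` reduces to the unit sphere; a zero `g j`, left out of the generators, imposes
no condition. -/
lemma mem_momCone_of_normalizedGenerators {y : MonIdx n (2 * k) → ℝ}
    (h : ∀ p ∈ normalizedGenerators g k, 0 ≤ riesz y p) : y ∈ momCone g k := by
  refine mem_momCone_iff.2 ⟨fun q hq => ?_, fun j q hq => ?_⟩
  · have := toPoly_smul_sq_nonneg (ψ := rieszLin y) (p := 1) (fun w hw => by
      rw [rieszLin_apply, one_mul]
      exact h _ (Or.inl ⟨w, hw, rfl⟩)) hq
    rwa [rieszLin_apply, one_mul] at this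
  · by_cases hj : g j = 0
    · rw [hj, zero_mul, ← rieszLin_apply, map_zero]
    · have := toPoly_smul_sq_nonneg (ψ := rieszLin y) (p := g j) (fun w hw => by
        rw [rieszLin_apply]
        exact h _ (Or.inr (Set.mem_biUnion (x := j) hj ⟨w, hw, rfl⟩))) hq
      rwa [rieszLin_apply] at this

lemma toPoly_ne_zero {w : MonIdx n r → ℝ} (hw : w ∈ Metric.sphere 0 1) : toPoly w ≠ 0 := by
  intro h
  have := coeffVec_toPoly w
  rw [h, map_zero] at this
  simp [← this] at hw

/-- The reason for leaving out zero `g j`: the strictly positive sequence is to be positive on every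
generator. -/
lemma ne_zero_of_mem_normalizedGenerators {p : MvPolynomial (Fin n) ℝ}
    (hp : p ∈ normalizedGenerators g k) : p ≠ 0 := by
  obtain ⟨w, hw, rfl⟩ | hp := hp
  · exact pow_ne_zero 2 (toPoly_ne_zero hw)
  · simp only [Set.mem_iUnion] at hp
    obtain ⟨j, hj, w, hw, rfl⟩ := hp
    exact mul_ne_zero hj (pow_ne_zero 2 (toPoly_ne_zero hw))

/-- A polynomial that vanishes on a nonempty open set is zero. -/
lemma eq_zero_of_eval_eq_zero_on_ball {p : MvPolynomial (Fin n) ℝ} {x₀ : Fin n → ℝ} {δ : ℝ}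
    (hδ : 0 < δ) (h : ∀ x ∈ Metric.ball x₀ δ, eval x p = 0) : p = 0 := by
  refine funext_set (fun i => Metric.ball (x₀ i) δ) (fun i => ?_) fun x hx => ?_
  · rw [Real.ball_eq_Ioo]
    exact Set.Ioo_infinite (by linarith)
  · rw [h x (by rwa [← ball_pi x₀ hδ] at hx), map_zero]

/-- A compact set with nonempty interior carries a measure whose moments are strictly positive on
the nonzero polynomials of the truncated quadratic module. -/
lemma exists_mem_momCone_pos (hk : minOrder g ≤ k) (hK : IsCompact (semialgSet g))
    (hint : (interior (semialgSet g)).Nonempty) :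
    ∃ z ∈ momCone g k, ∀ p ∈ quadModule g k, p ≠ 0 → 0 < riesz z p := by
  obtain ⟨x₀, hx₀⟩ := hint
  obtain ⟨δ, hδ, hball⟩ := Metric.isOpen_iff.1 isOpen_interior x₀ hx₀
  have hball' := hball.trans interior_subset
  -- Lebesgue measure on a small ball inside `X`: a polynomial nonnegative on `X` with zero integral
  -- vanishes on the ball, hence identically.
  set μ := (volume : Measure (Fin n → ℝ)).restrict (Metric.ball x₀ δ) with hμdef
  have hμ : IsMeasureOn (semialgSet g) μ := by
    refine ⟨⟨?_⟩, ?_⟩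
    · rw [Measure.restrict_apply_univ]
      exact measure_ball_lt_top
    · rw [Measure.restrict_apply' measurableSet_ball,
        (Set.disjoint_compl_left_iff_subset.2 hball').inter_eq, measure_empty]
  refine ⟨momentSeq n (2 * k) μ, momentSeq_mem_momCone hk hK hμ, fun p hp hp0 => ?_⟩
  rw [riesz_momentSeq hK hμ (totalDegree_le_of_mem_quadModule hk hp)]
  have hpos : ∀ x ∈ semialgSet g, 0 ≤ eval x p := fun x hx => eval_nonneg_of_mem_quadModule hp hx
  refine lt_of_le_of_ne (integral_nonneg_of_ae (hμ.ae_mem.mono fun x hx => hpos x hx)) fun h => ?_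
  refine hp0 (eq_zero_of_eval_eq_zero_on_ball (x₀ := x₀) hδ fun x hx =>
    eval_eq_zero_of_integral_eq_zero hK hμ hpos h.symm ?_)
  refine Measure.interior_inter_support ⟨?_, ?_⟩
  · rwa [Metric.isOpen_ball.interior_eq]
  · rw [Measure.support_eq_univ]
    trivial

/-- In finite dimension, the convex hull of a compact set is compact. -/
lemma _root_.IsCompact.convexHull_of_finiteDimensional {E : Type*} [NormedAddCommGroup E]
    [NormedSpace ℝ E] [FiniteDimensional ℝ E] {K : Set E} (hK : IsCompact K) :
    IsCompact (convexHull ℝ K) := by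
  classical
  -- Carathéodory's number: the hull is the continuous image of a simplex times `N` copies of `K`,
  -- with shorter combinations padded by zero weights.
  set N := Module.finrank ℝ E + 1
  let F : (Fin N → ℝ) × (Fin N → E) → E := fun p => ∑ i, p.1 i • p.2 i
  have hF : Continuous F := by fun_prop
  have hc : IsCompact (stdSimplex ℝ (Fin N) ×ˢ Set.univ.pi fun _ : Fin N => K) :=
    (isCompact_stdSimplex ℝ (Fin N)).prod (isCompact_univ_pi fun _ => hK)
  have hsub : convexHull ℝ K ⊆ F '' (stdSimplex ℝ (Fin N) ×ˢ Set.univ.pi fun _ : Fin N => K) := by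
    intro x hx
    obtain ⟨ι, _, z, w, hz, hind, hw, hw1, rfl⟩ := eq_pos_convex_span_of_mem_convexHull hx
    obtain ⟨x₀, hx₀⟩ : K.Nonempty := convexHull_nonempty_iff.1 ⟨_, hx⟩
    have hcard : Fintype.card ι ≤ Fintype.card (Fin N) := by
      rw [Fintype.card_fin]
      exact hind.card_le_finrank_succ.trans (Nat.succ_le_succ (Submodule.finrank_le _))
    obtain ⟨e⟩ := Function.Embedding.nonempty_of_card_le hcard
    have hw' : ∀ i ∉ Set.range e, Function.extend e w 0 i = 0 := fun i hi =>
      Function.extend_apply' _ _ _ hi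
    refine ⟨(Function.extend e w 0, Function.extend e z fun _ => x₀), ⟨⟨fun i => ?_, ?_⟩, ?_⟩, ?_⟩
    · by_cases hi : i ∈ Set.range e
      · obtain ⟨l, rfl⟩ := hi
        simpa [e.injective.extend_apply] using (hw l).le
      · exact (hw' i hi).ge
    · rw [← hw1]
      exact (Fintype.sum_of_injective e e.injective _ _ hw' fun i => by
        rw [e.injective.extend_apply]).symm
    · intro i _
      by_cases hi : i ∈ Set.range e
      · obtain ⟨l, rfl⟩ := hi
        simpa [e.injective.extend_apply] using hz ⟨l, rfl⟩
      · simpa only [Function.extend_apply' _ _ _ hi] using hx₀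
    · refine (Fintype.sum_of_injective e e.injective _ _ (fun i hi => ?_) fun i => ?_).symm
      · simp only [hw' i hi, zero_smul]
      · simp only [e.injective.extend_apply]
  have heq : convexHull ℝ K = F '' (stdSimplex ℝ (Fin N) ×ˢ Set.univ.pi fun _ : Fin N => K) := by
    refine hsub.antisymm ?_
    rintro _ ⟨⟨w, z⟩, ⟨hw, hz⟩, rfl⟩
    exact (convex_convexHull ℝ K).sum_mem (fun i _ => hw.1 i) hw.2
      fun i _ => subset_convexHull ℝ K (hz i trivial)
  rw [heq]
  exact hc.image hF

/-- Generators of the conic part of the duality space. -/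
def conicGenerators (g : Fin nX → MvPolynomial (Fin n) ℝ) (k : ℕ) : Set (DualitySpace n k) :=
  (coeffVec n (2 * k) '' normalizedGenerators g k) ×ˢ {0} ∪
    ({0} ×ˢ ((coeffVec n (2 * k) '' normalizedGenerators g k) ×ˢ {0}) ∪ {(0, 0, -1)})

lemma isCompact_conicGenerators : IsCompact (conicGenerators g k) :=
  ((isCompact_coeffVec_normalizedGenerators _).prod isCompact_singleton).union
    ((isCompact_singleton.prod ((isCompact_coeffVec_normalizedGenerators _).prod
      isCompact_singleton)).union isCompact_singleton)

lemma forall_mem_conicGenerators {P : DualitySpace n k → Prop}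
    (h1 : ∀ p ∈ normalizedGenerators g k, P (coeffVec n (2 * k) p, 0, 0))
    (h2 : ∀ p ∈ normalizedGenerators g k, P (0, coeffVec n (2 * k) p, 0))
    (h3 : P (0, 0, -1)) : ∀ e ∈ conicGenerators g k, P e := by
  rintro ⟨v, w, t⟩ (⟨⟨p, hp, rfl⟩, h⟩ | ⟨h, ⟨p, hp, rfl⟩, h'⟩ | h)
  · obtain ⟨rfl, rfl⟩ := Prod.mk.inj h
    exact h1 p hp
  · obtain rfl : v = 0 := h
    obtain rfl : t = 0 := h'
    exact h2 p hp
  · rw [Set.mem_singleton_iff.1 h]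
    exact h3

lemma fst_mem_conicGenerators {p : MvPolynomial (Fin n) ℝ} (hp : p ∈ normalizedGenerators g k) :
    (coeffVec n (2 * k) p, 0, 0) ∈ conicGenerators g k := Or.inl ⟨⟨p, hp, rfl⟩, rfl⟩

lemma snd_mem_conicGenerators {p : MvPolynomial (Fin n) ℝ} (hp : p ∈ normalizedGenerators g k) :
    (0, coeffVec n (2 * k) p, 0) ∈ conicGenerators g k :=
  Or.inr (Or.inl ⟨rfl, ⟨p, hp, rfl⟩, rfl⟩)

lemma thd_mem_conicGenerators : (0, 0, -1) ∈ conicGenerators g k := Or.inr (Or.inr rfl)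

lemma conicGenerators_subset : conicGenerators g k ⊆ conicPart g k :=
  forall_mem_conicGenerators
    (fun p hp => ⟨p, normalizedGenerators_subset hp, 0, zero_mem_quadModule, 0, le_rfl, by simp⟩)
    (fun p hp => ⟨0, zero_mem_quadModule, p, normalizedGenerators_subset hp, 0, le_rfl, by simp⟩)
    ⟨0, zero_mem_quadModule, 0, zero_mem_quadModule, 1, zero_le_one, by simp⟩

/-- Absence of a duality gap for sets with nonempty interior. -/
theorem exists_sosFeasible_of_interior (hK : IsCompact (semialgSet g))
    (hint : (interior (semialgSet g)).Nonempty)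
    (hk : minOrder g ≤ k) (ha : ∀ i, (a i).totalDegree ≤ k)
    {yp ym : MonIdx n (2 * k) → ℝ} (hy : MomOptimal g a b k yp ym) {c : ℝ}
    (hc : c < riesz yp 1 + riesz ym 1) : ∃ v, SOSFeasible g a k v ∧ c ≤ b ⬝ᵥ v := by
  obtain ⟨z, hz, hzpos⟩ := exists_mem_momCone_pos hk hK hint
  have hzgen : ∀ p ∈ normalizedGenerators g k, 0 < riesz z p := fun p hp =>
    hzpos p (normalizedGenerators_subset hp) (ne_zero_of_mem_normalizedGenerators hp)
  -- The Slater point adds the same `z` to both sequences, so the equality constraints, which see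
  -- only their difference, persist.
  have hslater : ∀ e ∈ convexHull ℝ (conicGenerators g k), 0 < pairing (yp + z) (ym + z) 1 e := by
    refine convexHull_min (t := {e | 0 < pairing (yp + z) (ym + z) 1 e}) ?_
      (convex_halfSpace_gt (pairing (yp + z) (ym + z) 1).isLinear 0)
    refine forall_mem_conicGenerators (fun p hp => ?_) (fun p hp => ?_) ?_
    · change 0 < pairing _ _ _ _
      rw [pairing_fst, riesz_add_left]
      exact add_pos_of_nonneg_of_pos
        (riesz_nonneg_of_mem_quadModule hy.1.1 (normalizedGenerators_subset hp)) (hzgen p hp)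
    · change 0 < pairing _ _ _ _
      rw [pairing_snd, riesz_add_left]
      exact add_pos_of_nonneg_of_pos
        (riesz_nonneg_of_mem_quadModule hy.1.2.1 (normalizedGenerators_subset hp)) (hzgen p hp)
    · change 0 < pairing _ _ _ _
      rw [pairing_thd]
      norm_num
  have hslater0 : ∀ v, pairing (yp + z) (ym + z) 1 (constraintMap a b k v) = 0 := by
    intro v
    rw [pairing_constraintMap]
    refine Finset.sum_eq_zero fun i _ => ?_
    have := hy.1.2.2 i
    rw [riesz_add_left, riesz_add_left, ← this]
    ring
  have hGne : (conicGenerators g k).Nonempty := ⟨_, thd_mem_conicGenerators⟩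
  -- If this compact hull misses the constraint range, strict separation gives a moment pair of
  -- value below `c`. If they meet, the intersection point is solved for an SOS-feasible vector.
  set S := convexHull ℝ (insert (-valuePoint n k c) (conicGenerators g k)) with hS
  set L := LinearMap.range (constraintMap a b k) with hL
  by_cases hdisj : Disjoint S (L : Set (DualitySpace n k))
  · exfalso
    obtain ⟨f, s, t, hfs, hst, hft⟩ := geometric_hahn_banach_compact_closed
      (convex_convexHull ℝ _) (IsCompact.insert isCompact_conicGenerators _).convexHull_of_finiteDimensional
      L.convex L.closed_of_finiteDimensional hdisj
    have ht : t < 0 := by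
      have := hft 0 L.zero_mem
      rwa [map_zero] at this
    have hfL : ∀ v, f (constraintMap a b k v) = 0 := by
      intro v
      by_contra h
      -- A linear form bounded below on a subspace vanishes there: otherwise this multiple would
      -- attain the excluded value `t`.
      have := hft _ ⟨(t / f (constraintMap a b k v)) • v, rfl⟩
      rw [map_smul, map_smul, smul_eq_mul, div_mul_cancel₀ _ h] at this
      exact lt_irrefl _ this
    obtain ⟨zp, zm, τ, hpair⟩ := exists_eq_pairing (-f.toLinearMap)
    have hpair' : ∀ e, pairing zp zm τ e = -f e := fun e => by rw [← hpair]; rfl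
    have hpos : ∀ e ∈ insert (-valuePoint n k c) (conicGenerators g k),
        0 < pairing zp zm τ e := fun e he => by
      have := hfs e (subset_convexHull ℝ _ he)
      rw [hpair']
      linarith
    have hzp : zp ∈ momCone g k := mem_momCone_of_normalizedGenerators fun p hp => by
      rw [← pairing_fst zp zm τ]
      exact (hpos _ (Or.inr (fst_mem_conicGenerators hp))).le
    have hzm : zm ∈ momCone g k := mem_momCone_of_normalizedGenerators fun p hp => by
      rw [← pairing_snd zp zm τ]
      exact (hpos _ (Or.inr (snd_mem_conicGenerators hp))).le
    have hτ : 0 < τ := by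
      have := hpos _ (Or.inr thd_mem_conicGenerators)
      rw [pairing_thd] at this
      linarith
    have hval := hpos _ (Or.inl rfl)
    rw [map_neg, valuePoint, pairing_coeffVec] at hval
    have := hy.mul_le hτ hzp hzm (riesz_constraint_of_pairing fun v => by
      rw [hpair', hfL, neg_zero])
    nlinarith
  · obtain ⟨_, hxS, v, rfl⟩ := Set.not_disjoint_iff.1 hdisj
    rw [hS, convexHull_insert hGne, mem_convexJoin] at hxS
    obtain ⟨_, rfl, e, he, α, β, hα, hβ, hαβ, h⟩ := hxS
    have heD : e ∈ conicPart g k := convexHull_min conicGenerators_subset convex_conicPart he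
    -- The weight `α` of `-valuePoint` cannot be zero, since the Slater functional is positive on
    -- the hull of the generators and zero on the range.
    obtain rfl | hα := hα.eq_or_lt
    · exfalso
      rw [zero_add] at hαβ
      rw [hαβ, zero_smul, zero_add, one_smul] at h
      exact (hslater e he).ne' (h ▸ hslater0 v)
    -- Solving `-α • valuePoint + β • e = constraintMap v` for `valuePoint`.
    · refine ⟨_, exists_sosFeasible_of_valuePoint_eq hk ha
        (smul_mem_conicPart heD (div_nonneg hβ hα.le)) (-(α⁻¹ • v)) ?_⟩
      rw [map_neg, map_smul, ← h, smul_add, smul_neg, smul_neg, inv_smul_smul₀ hα.ne', smul_smul,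
        div_eq_inv_mul]
      abel

/-! ### Optimality of the representing measures -/

lemma MomOptimal.le_dotProduct
    (hX : (∃ (j : Fin nX) (R : ℝ), g j = ballPoly n R) ∨
      (IsArchimedean g ∧ (interior (semialgSet g)).Nonempty))
    (hk : minOrder g ≤ k) (ha : ∀ i, (a i).totalDegree ≤ k)
    {yp ym : MonIdx n (2 * k) → ℝ} (hy : MomOptimal g a b k yp ym) {u : Fin m → ℝ}
    (hu : SOSOptimal g a b k u) : riesz yp 1 + riesz ym 1 ≤ b ⬝ᵥ u := by
  refine le_of_forall_lt fun c hc => ?_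
  obtain ⟨c', hcc', hc'⟩ := exists_between hc
  obtain ⟨v, hv, hcv⟩ : ∃ v, SOSFeasible g a k v ∧ c' ≤ b ⬝ᵥ v := by
    obtain ⟨j, R, hj⟩ | ⟨hA, hint⟩ := hX
    · exact exists_sosFeasible_of_ballPoly hj hk ha hy hc'
    · exact exists_sosFeasible_of_interior (isCompact_semialgSet (Or.inr hA)) hint hk ha hy hc'
  exact hcc'.trans_le (hcv.trans (hu.2 v hv))

end MomentSOS

/-! ### Complementary slackness and the main theorem. -/

open MomentSOS
theorem mainTheorem5 {n nX m : ℕ} (hn : 0 < n)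
    (g : Fin nX → MvPolynomial (Fin n) ℝ)
    (hX : (∃ (j : Fin nX) (R : ℝ), g j = ballPoly n R) ∨
      (IsArchimedean g ∧ (interior (semialgSet g)).Nonempty))
    (d : ℕ) (a : Fin m → MvPolynomial (Fin n) ℝ) (ha : ∀ i, (a i).totalDegree ≤ d)
    (b : Fin m → ℝ)
    (k : ℕ) (hk : max d (minOrder g) ≤ k)
    (yp ym : MonIdx n (2 * k) → ℝ) (hy : MomOptimal g a b k yp ym)
    (hrankp : (momMatrix (k - minOrder g) yp).rank = (momMatrix k yp).rank)
    (hrankm : (momMatrix (k - minOrder g) ym).rank = (momMatrix k ym).rank)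
    (u : Fin m → ℝ) (hu : SOSOptimal g a b k u) :
    (∃ μp μm : Measure (Fin n → ℝ),
      Represents (semialgSet g) yp μp ∧ Represents (semialgSet g) ym μm) ∧
    ∀ μp μm : Measure (Fin n → ℝ),
      Represents (semialgSet g) yp μp → Represents (semialgSet g) ym μm →
      LPOptimal g a b μp μm ∧
      μp.support.encard = (momMatrix k yp).rank ∧ μp.support ⊆ semialgSet g ∧
      μm.support.encard = (momMatrix k ym).rank ∧ μm.support ⊆ semialgSet g ∧
      (∀ x ∈ μp.support, eval x (1 - lincomb a u) = 0) ∧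
      (∀ x ∈ μm.support, eval x (1 + lincomb a u) = 0) ∧
      IsCertificate g a b u μp μm := by
  have hkX : minOrder g ≤ k := (le_max_right _ _).trans hk
  have hak : ∀ i, (a i).totalDegree ≤ k := fun i => (ha i).trans ((le_max_left _ _).trans hk)
  have ha2k : ∀ i, (a i).totalDegree ≤ 2 * k := fun i => (hak i).trans (by omega)
  have hK : IsCompact (semialgSet g) := isCompact_semialgSet (hX.imp_right And.left)
  obtain ⟨Sp, wp, hwp, hsump, hqp, hSpX, hcardp⟩ := exists_atoms_of_flat hkX hy.1.1 hrankp
  obtain ⟨Sm, wm, hwm, hsumm, hqm, hSmX, hcardm⟩ := exists_atoms_of_flat hkX hy.1.2.1 hrankm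
  obtain ⟨νp, hνp⟩ := exists_represents_of_atoms hwp hsump hSpX
  obtain ⟨νm, hνm⟩ := exists_represents_of_atoms hwm hsumm hSmX
  refine ⟨⟨νp, νm, hνp, hνm⟩, fun μp μm hμp hμm => ?_⟩
  have hsuppp : μp.support = Sp := support_eq_of_atoms hK hwp hsump hqp hμp
  have hsuppm : μm.support = Sm := support_eq_of_atoms hK hwm hsumm hqm hμm
  have hmass : ∀ {y : MonIdx n (2 * k) → ℝ} {μ : Measure (Fin n → ℝ)},
      Represents (semialgSet g) y μ → riesz y 1 = μ.real Set.univ := by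
    intro y μ h
    rw [h.riesz_eq_integral hK (by simp)]
    simp
  have hfeas : ∀ i, ∫ x, eval x (a i) ∂μp - ∫ x, eval x (a i) ∂μm = b i := fun i => by
    rw [← hμp.riesz_eq_integral hK (ha2k i), ← hμm.riesz_eq_integral hK (ha2k i)]
    exact hy.1.2.2 i
  have hLP : LPOptimal g a b μp μm := by
    refine ⟨⟨hμp.1, hμm.1, hfeas⟩, fun ρp ρm hρ => ?_⟩
    have h := hy.2 (momentSeq n (2 * k) ρp) (momentSeq n (2 * k) ρm)
      ⟨momentSeq_mem_momCone hkX hK hρ.1, momentSeq_mem_momCone hkX hK hρ.2.1, fun i => by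
        rw [riesz_momentSeq hK hρ.1 (ha2k i), riesz_momentSeq hK hρ.2.1 (ha2k i)]
        exact hρ.2.2 i⟩
    rwa [hmass hμp, hmass hμm, hmass (y := momentSeq n (2 * k) ρp) ⟨hρ.1, fun _ => rfl⟩,
      hmass (y := momentSeq n (2 * k) ρm) ⟨hρ.2.1, fun _ => rfl⟩] at h
  -- `ℓ_{y₊}(1 - aᵀu)` and `ℓ_{y₋}(1 + aᵀu)` are nonnegative, and their sum is the total mass minus
  -- `bᵀu`, which is at most zero by the absence of a gap. Hence both vanish.
  have hgap := hy.le_dotProduct hX hkX hak hu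
  have hp0 := riesz_nonneg_of_mem_quadModule hy.1.1 hu.1.2
  have hm0 := riesz_nonneg_of_mem_quadModule hy.1.2.1 hu.1.1
  have hbu : riesz yp (lincomb a u) - riesz ym (lincomb a u) = b ⬝ᵥ u := by
    rw [riesz_lincomb, riesz_lincomb, ← Finset.sum_sub_distrib]
    refine Finset.sum_congr rfl fun i _ => ?_
    rw [← hy.1.2.2 i]
    ring
  rw [riesz_sub] at hp0
  rw [riesz_add] at hm0
  have hzp : ∀ x ∈ μp.support, eval x (1 - lincomb a u) = 0 := fun x hx => by
    refine eval_eq_zero_of_integral_eq_zero hK hμp.1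
      (fun x hx => eval_nonneg_of_mem_quadModule hu.1.2 hx) ?_ hx
    rw [← hμp.riesz_eq_integral hK (totalDegree_le_of_mem_quadModule hkX hu.1.2), riesz_sub]
    linarith
  have hzm : ∀ x ∈ μm.support, eval x (1 + lincomb a u) = 0 := fun x hx => by
    refine eval_eq_zero_of_integral_eq_zero hK hμm.1
      (fun x hx => eval_nonneg_of_mem_quadModule hu.1.1 hx) ?_ hx
    rw [← hμm.riesz_eq_integral hK (totalDegree_le_of_mem_quadModule hkX hu.1.1), riesz_add]
    linarith
  refine ⟨hLP, ?_, hsuppp ▸ hSpX, ?_, hsuppm ▸ hSmX, hzp, hzm, fun x hx => ?_, fun x hx => ?_,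
    fun x hx => ?_, ?_⟩
  · rw [hsuppp, Set.encard_coe_eq_coe_finsetCard, hcardp]
  · rw [hsuppm, Set.encard_coe_eq_coe_finsetCard, hcardm]
  · have h1 := eval_nonneg_of_mem_quadModule hu.1.1 hx
    have h2 := eval_nonneg_of_mem_quadModule hu.1.2 hx
    rw [map_add, map_one] at h1
    rw [map_sub, map_one] at h2
    exact abs_le.2 ⟨by linarith, by linarith⟩
  · have := hzp x hx
    rw [map_sub, map_one] at this
    linarith
  · have := hzm x hx
    rw [map_add, map_one] at this
    linarith
  · rw [← hmass hμp, ← hmass hμm]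
    linarith
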